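/- **Theorem.** Let $\mathcal M$ be a smooth $n$-dimensional manifold (Hausdorff, $\sigma$-compact, without boundary), and let $C_c^\infty(\mathcal M)$ be the algebra of smooth compactly supported complex-valued functions on $\mathcal M$. A *smooth deformation* (to second order) of $\mathcal M$ consists of a commutative $\mathbb C$-algebra $\Bbbk$, an associative, not necessarily unital $\Bbbk$-algebra $\mathbb A$, an element $\kappa\in\Bbbk$, and an isomorphism of $\mathbb C$-algebras $C_c^\infty(\mathcal M)\cong\mathbb A/\kappa\mathbb A$, such that $\mathbb A/\kappa^3\mathbb A$ is a free $\mathbb C[\kappa]/(\kappa^3)$-module. Its Poisson bracket on $C_c^\infty(\mathcal M)$ is defined by $$\kappa\{f,g\}=i(ab-ba) \bmod \kappa^2,\qquad f=a\bmod\kappa,\ g=b\bmod\kappa ,$$ that is, $\{f,g\}=c\bmod\kappa$ for any $c\in\mathbb A$ with $\kappa c-i(ab-ba)\in\kappa^2\mathbb A$. Let $\mathbb A$ be a smooth deformation of $\mathcal M$, and let $\epsilon$ be a volume form on $\mathcal M$ (a smooth nowhere vanishing real $n$-form; integrals are taken with respect to the orientation defined by $\epsilon$). Suppose that there is a $\Bbbk$-linear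 map $\tau:\mathbb A\to\Bbbk$ with $\tau(ab)=\tau(ba)$ for all $a,b\in\mathbb A$, such that for all $a\in\mathbb A$, with $f=a\bmod\kappa$, $$\int_{\mathcal M} f\,\epsilon=\tau(a)\bmod\kappa\quad\text{in }\Bbbk/\kappa\Bbbk .$$ 1. There is a unique smooth (complex) bivector field $\pi$ on $\mathcal M$, the Poisson bivector field, such that $\{f,g\}=\pi(df,dg)=\pi^{ij}\,\partial_if\,\partial_jg$ for all $f,g\in C_c^\infty(\mathcal M)$. 2. This $\pi$ satisfies $$d(\pi\lrcorner\epsilon)=0,\qquad\text{where } (\pi\lrcorner\epsilon)_{ij\cdots}=\tfrac12\pi^{ab}\epsilon_{abij\cdots}$$ (a form of degree $n-2$, understood to be $0$ if $n<2$), and $\nabla_j\pi^{ij}=0$ for every torsion-free connection $\nabla$ on $T\mathcal M$ with $\nabla\epsilon=0$. 3. These two conditions are equivalent: for every smooth complex bivector field $\pi$ on $\mathcal M$ and every torsion-free connection $\nabla$ on $T\mathcal M$ with $\nabla\epsilon=0$, one has $d(\pi\lrcorner\epsilon)=0$ if and only if $\nabla_j\pi^{ij}=0$. -/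

import Mathlib

open scoped Manifold ContDiff

noncomputable section

namespace NCDeformation

/-! ### Smooth functions with compact support -/

/-- The commutative, generally non-unital `ℂ`-algebra of smooth compactly supported
complex-valued functions on the `n`-dimensional manifold `M`, with pointwise operations. -/
def SmoothCompact (n : ℕ) (M : Type*) [TopologicalSpace M]
    [ChartedSpace (EuclideanSpace ℝ (Fin n)) M] : NonUnitalSubalgebra ℂ (M → ℂ) where
  carrier := {f | ContMDiff (𝓡 n) 𝓘(ℝ, ℂ) ∞ f ∧ HasCompactSupport f}
  add_mem' hf hg := ⟨hf.1.add hg.1, hf.2.add hg.2⟩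
  zero_mem' := ⟨contMDiff_const, HasCompactSupport.zero⟩
  mul_mem' hf hg := ⟨contDiff_mul.comp_contMDiff (hf.1.prodMk_space hg.1), hf.2.mul_right⟩
  smul_mem' c _ hf :=
    ⟨contDiff_mul.comp_contMDiff ((contMDiff_const (c := c)).prodMk_space hf.1),
      hf.2.mul_left (f := fun _ => c)⟩

/-! ### Smooth deformations and their Poisson bracket -/

section Algebra

set_option linter.unusedSectionVars false

variable (n : ℕ) (M : Type*) [TopologicalSpace M] [ChartedSpace (EuclideanSpace ℝ (Fin n)) M]
  (𝕜 A : Type*) [CommRing 𝕜] [Algebra ℂ 𝕜] [NonUnitalRing A] [Module 𝕜 A]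
  [IsScalarTower 𝕜 A A] [SMulCommClass 𝕜 A A] [Module ℂ A] [IsScalarTower ℂ 𝕜 A]

/-- The submodule (two-sided ideal) `κ A` of the `𝕜`-algebra `A`. -/
abbrev scaled {𝕜 : Type*} (A : Type*) [CommRing 𝕜] [NonUnitalRing A] [Module 𝕜 A] (κ : 𝕜) :
    Submodule 𝕜 A :=
  LinearMap.range (LinearMap.lsmul 𝕜 A κ)

/-- If `N / X³ N` is free over `ℂ[X]/(X³)`, then an element of `N` killed by `X` lies in `X² N`. -/
theorem exists_of_X_smul_eq_zero {N : Type*} [AddCommGroup N] [Module (Polynomial ℂ) N]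
    (hfree : Module.Free (Polynomial ℂ ⧸ Ideal.span {(Polynomial.X ^ 3 : Polynomial ℂ)})
      (N ⧸ (Ideal.span {(Polynomial.X ^ 3 : Polynomial ℂ)} • (⊤ : Submodule (Polynomial ℂ) N))))
    {u : N} (hu : (Polynomial.X : Polynomial ℂ) • u = 0) :
    ∃ w : N, u = (Polynomial.X ^ 2 : Polynomial ℂ) • w := by
  let I : Ideal (Polynomial ℂ) := Ideal.span {(Polynomial.X ^ 3 : Polynomial ℂ)}
  let Q := N ⧸ (I • (⊤ : Submodule (Polynomial ℂ) N))
  let x : Polynomial ℂ ⧸ I := Ideal.Quotient.mk I Polynomial.X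
  have hker : ∀ r : Polynomial ℂ ⧸ I, x * r = 0 → ∃ s : Polynomial ℂ ⧸ I, r = x ^ 2 * s := by
    intro r hr
    obtain ⟨p, rfl⟩ := Ideal.Quotient.mk_surjective r
    have h1 : (Polynomial.X ^ 3 : Polynomial ℂ) ∣ Polynomial.X * p := by
      rw [← Ideal.mem_span_singleton, ← Ideal.Quotient.eq_zero_iff_mem, map_mul]
      exact hr
    rw [pow_succ', mul_dvd_mul_iff_left Polynomial.X_ne_zero] at h1
    obtain ⟨q, rfl⟩ := h1
    exact ⟨Ideal.Quotient.mk _ q, by simp [x, map_mul, map_pow]⟩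
  let b := Module.Free.chooseBasis (Polynomial ℂ ⧸ I) Q
  let v : Q := Submodule.Quotient.mk u
  have hv : x • v = 0 := by
    have h : x • v = Submodule.Quotient.mk ((Polynomial.X : Polynomial ℂ) • u) := rfl
    rw [h, hu, Submodule.Quotient.mk_zero]
  have hv2 : v ∈ LinearMap.range (LinearMap.lsmul (Polynomial ℂ ⧸ I) Q (x ^ 2)) := by
    rw [← b.linearCombination_repr v, Finsupp.linearCombination_apply]
    refine Submodule.sum_mem _ fun i _ => ?_
    obtain ⟨s, hs⟩ := hker (b.repr v i) (by
      have h : b.repr (x • v) i = 0 := by rw [hv, map_zero, Finsupp.zero_apply]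
      simpa using h)
    exact ⟨s • b i, by rw [hs, LinearMap.lsmul_apply, smul_smul]⟩
  obtain ⟨w, hw⟩ := hv2
  obtain ⟨w, rfl⟩ := Submodule.Quotient.mk_surjective _ w
  have hw' : (Submodule.Quotient.mk ((Polynomial.X ^ 2 : Polynomial ℂ) • w) : Q) =
      Submodule.Quotient.mk u := hw
  rw [eq_comm, Submodule.Quotient.eq, Submodule.ideal_span_singleton_smul] at hw'
  obtain ⟨t, -, ht⟩ := hw'
  refine ⟨w + (Polynomial.X : Polynomial ℂ) • t, ?_⟩
  have ht' : (Polynomial.X ^ 3 : Polynomial ℂ) • t = u - (Polynomial.X ^ 2 : Polynomial ℂ) • w := ht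
  rw [smul_add, smul_smul, ← pow_succ, ht']
  abel

/-- A smooth deformation (to second order) of the manifold `M`: a commutative `ℂ`-algebra `𝕜`,
an associative (possibly non-unital) `𝕜`-algebra `A`, an element `κ ∈ 𝕜` and an isomorphism of
`ℂ`-algebras `A / κ A ≅ C_c^∞(M)`, such that `A / κ³ A` is a free `ℂ[κ]/(κ³)`-module. -/
structure SmoothDeformation where
  /-- The deformation parameter. -/
  κ : 𝕜
  /-- The isomorphism `A / κ A ≅ C_c^∞(M)`, as a `ℂ`-linear bijection. -/
  classical : (A ⧸ scaled A κ) ≃ₗ[ℂ] SmoothCompact n M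
  /-- The isomorphism is multiplicative. -/
  classical_mul : ∀ a b : A, classical (Submodule.Quotient.mk (a * b)) =
    classical (Submodule.Quotient.mk a) * classical (Submodule.Quotient.mk b)
  /-- Here `Module.AEval ℂ A κ` is `A`, viewed as a `ℂ[X]`-module on which `X` acts as `κ`, so
  that `X³` times the whole module is `κ³ A`. -/
  free : Module.Free (Polynomial ℂ ⧸ Ideal.span {(Polynomial.X ^ 3 : Polynomial ℂ)})
    (Module.AEval ℂ A κ ⧸
      (Ideal.span {(Polynomial.X ^ 3 : Polynomial ℂ)} •
        (⊤ : Submodule (Polynomial ℂ) (Module.AEval ℂ A κ))))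

namespace SmoothDeformation

variable {n M 𝕜 A}
variable (D : SmoothDeformation n M 𝕜 A)

/-- The reduction `a mod κ` of `a ∈ A`, as a function in `C_c^∞(M)`. -/
def reduce (a : A) : SmoothCompact n M := D.classical (Submodule.Quotient.mk a)

theorem reduce_surjective : Function.Surjective D.reduce :=
  D.classical.surjective.comp (Submodule.Quotient.mk_surjective _)

theorem reduce_eq_iff {a b : A} : D.reduce a = D.reduce b ↔ ∃ c : A, D.κ • c = a - b := by
  rw [reduce, reduce, D.classical.injective.eq_iff, Submodule.Quotient.eq]
  rfl

/-- `h = {f, g}`: for all `a, b, c ∈ A` reducing to `f`, `g` and with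
`κ c = i (a b - b a)` modulo `κ² A`, the class of `c` modulo `κ` is `h`; moreover such
elements exist. -/
def IsBracket (f g h : SmoothCompact n M) : Prop :=
  (∃ a b c : A, D.reduce a = f ∧ D.reduce b = g ∧
    D.κ • c - Complex.I • (a * b - b * a) ∈ scaled A (D.κ ^ 2)) ∧
  ∀ a b c : A, D.reduce a = f → D.reduce b = g →
    D.κ • c - Complex.I • (a * b - b * a) ∈ scaled A (D.κ ^ 2) → D.reduce c = h

/-- Freeness of `A / κ³ A` implies that `κ c ∈ κ² A` only if `c ∈ κ A`. -/
theorem exists_smul_eq_of_smul_eq {c d : A} (h : D.κ • c = D.κ ^ 2 • d) :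
    ∃ e : A, D.κ • e = c := by
  have hu : (Polynomial.X : Polynomial ℂ) • Module.AEval.of ℂ A D.κ (c - D.κ • d) = 0 := by
    rw [Module.AEval.X_smul_of, smul_sub, h, pow_two, mul_smul, sub_self, map_zero]
  obtain ⟨w, hw⟩ := exists_of_X_smul_eq_zero D.free hu
  obtain ⟨w, rfl⟩ := (Module.AEval.of ℂ A D.κ).surjective w
  rw [Module.AEval.X_pow_smul_of] at hw
  have hw' := (Module.AEval.of ℂ A D.κ).injective hw
  exact ⟨d + D.κ • w, by rw [smul_add, smul_smul, ← pow_two, ← hw']; abel⟩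

/-- Commutators in `A` are multiples of `κ`, since `A / κ A` is commutative. -/
theorem commutator (a b : A) : ∃ c : A, D.κ • c = a * b - b * a :=
  D.reduce_eq_iff.1 (by
    rw [reduce, reduce, D.classical_mul, D.classical_mul]
    exact Subtype.ext (mul_comm _ _))

theorem existsUnique_isBracket (f g : SmoothCompact n M) : ∃! h, D.IsBracket f g h := by
  have uniq : ∀ a b c a' b' c' : A, D.reduce a = D.reduce a' → D.reduce b = D.reduce b' →
      D.κ • c - Complex.I • (a * b - b * a) ∈ scaled A (D.κ ^ 2) →
      D.κ • c' - Complex.I • (a' * b' - b' * a') ∈ scaled A (D.κ ^ 2) →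
      D.reduce c = D.reduce c' := by
    intro a b c a' b' c' ha hb hc hc'
    obtain ⟨u, hu⟩ := D.reduce_eq_iff.1 ha
    obtain ⟨v, hv⟩ := D.reduce_eq_iff.1 hb
    obtain ⟨p, hp⟩ := hc
    obtain ⟨p', hp'⟩ := hc'
    obtain ⟨q, hq⟩ := D.commutator u b
    obtain ⟨q', hq'⟩ := D.commutator a' v
    rw [D.reduce_eq_iff]
    apply D.exists_smul_eq_of_smul_eq (d := p - p' + Complex.I • (q + q'))
    rw [LinearMap.lsmul_apply] at hp hp'
    have e1 : a = a' + D.κ • u := by rw [hu]; abel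
    have e2 : b = b' + D.κ • v := by rw [hv]; abel
    have key : a * b - b * a - (a' * b' - b' * a') = D.κ ^ 2 • (q + q') := by
      rw [smul_add, pow_two, mul_smul, mul_smul, hq, hq', e1, e2]
      simp only [mul_add, add_mul, smul_mul_assoc, mul_smul_comm, smul_sub, smul_add]
      abel
    rw [smul_add, smul_sub (D.κ ^ 2), hp, hp', smul_comm (D.κ ^ 2) Complex.I, ← key]
    simp only [smul_sub]
    abel
  obtain ⟨a, rfl⟩ := D.reduce_surjective f
  obtain ⟨b, rfl⟩ := D.reduce_surjective g
  obtain ⟨q, hq⟩ := D.commutator a b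
  have hc : D.κ • (Complex.I • q) - Complex.I • (a * b - b * a) ∈ scaled A (D.κ ^ 2) := by
    rw [smul_comm, hq, sub_self]
    exact zero_mem _
  exact ⟨D.reduce (Complex.I • q), ⟨⟨a, b, _, rfl, rfl, hc⟩,
    fun a' b' c' ha hb h => uniq a' b' c' a b _ ha hb h hc⟩,
    fun h hh => (hh.2 a b _ rfl rfl hc).symm⟩

/-- The Poisson bracket on `C_c^∞(M)` of a smooth deformation: `κ {f, g} = i [a, b]` modulo `κ²`
for `f = a mod κ` and `g = b mod κ`. -/
def bracket (f g : SmoothCompact n M) : SmoothCompact n M :=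
  (D.existsUnique_isBracket f g).choose

end SmoothDeformation

end Algebra

/-! ### Differential forms, volume forms, integration -/

section Forms

variable {n : ℕ} {M : Type*} [TopologicalSpace M] [ChartedSpace (EuclideanSpace ℝ (Fin n)) M]
  {F : Type*} [NormedAddCommGroup F] [NormedSpace ℝ F] {k : ℕ}

/-- The pullback of the differential form `α` on `M` by the inverse of the preferred chart at
`x₀`; it is a differential form on the target of this chart. -/
def chartForm (α : ∀ x : M, TangentSpace (𝓡 n) x [⋀^Fin k]→L[ℝ] F) (x₀ : M)
    (y : EuclideanSpace ℝ (Fin n)) : EuclideanSpace ℝ (Fin n) [⋀^Fin k]→L[ℝ] F :=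
  (α ((extChartAt (𝓡 n) x₀).symm y)).compContinuousLinearMap
    (mfderiv 𝓘(ℝ, EuclideanSpace ℝ (Fin n)) (𝓡 n) (extChartAt (𝓡 n) x₀).symm y)

/-- Smoothness of a differential form, in charts. -/
def IsSmoothForm (α : ∀ x : M, TangentSpace (𝓡 n) x [⋀^Fin k]→L[ℝ] F) : Prop :=
  ∀ x₀ : M, ContDiffOn ℝ ∞ (chartForm α x₀) (extChartAt (𝓡 n) x₀).target

/-- The exterior derivative of a differential form on `M`, computed at `x` in the chart at `x`. -/
def exteriorDerivative (α : ∀ x : M, TangentSpace (𝓡 n) x [⋀^Fin k]→L[ℝ] F) (x : M) :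
    TangentSpace (𝓡 n) x [⋀^Fin (k + 1)]→L[ℝ] F :=
  (extDeriv (chartForm α x) (extChartAt (𝓡 n) x x)).compContinuousLinearMap
    (mfderiv (𝓡 n) 𝓘(ℝ, EuclideanSpace ℝ (Fin n)) (extChartAt (𝓡 n) x) x)

/-- A volume form: a smooth, nowhere vanishing, real differential form of top degree. -/
def IsVolumeForm (ε : ∀ x : M, TangentSpace (𝓡 n) x [⋀^Fin n]→L[ℝ] ℝ) : Prop :=
  IsSmoothForm ε ∧ ∀ x, ε x ≠ 0

/-- The coefficient of a top degree form `ε` in the preferred chart at `x₀`, i.e. the function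
`ρ` with `ε = ρ dx¹ ∧ ⋯ ∧ dxⁿ` on the target of the chart. -/
def chartDensity (ε : ∀ x : M, TangentSpace (𝓡 n) x [⋀^Fin n]→L[ℝ] ℝ) (x₀ : M)
    (y : EuclideanSpace ℝ (Fin n)) : ℝ :=
  chartForm ε x₀ y (fun i => EuclideanSpace.single i 1)

variable (n M) in
/-- A smooth partition of unity subordinate to the cover of `M` by the domains of the preferred
charts. -/
def chartPartition [IsManifold (𝓡 n) ∞ M] [T2Space M] [SigmaCompactSpace M] :
    SmoothPartitionOfUnity M (𝓡 n) M Set.univ :=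
  (SmoothPartitionOfUnity.exists_isSubordinate_chartAt_source (𝓡 n) M).choose

/-- The integral `∫_M f ε` of the compactly supported function `f` against the volume form `ε`,
for the orientation of `M` in which `ε` is positive: the functions `ρ_c f`, with `ρ_c` a partition
of unity subordinate to charts, are integrated in the charts. Since `ε` is positive, its density
with respect to Lebesgue measure is the absolute value of its coefficient. -/
def integral [IsManifold (𝓡 n) ∞ M] [T2Space M] [SigmaCompactSpace M]
    (ε : ∀ x : M, TangentSpace (𝓡 n) x [⋀^Fin n]→L[ℝ] ℝ) (f : M → ℂ) : ℂ :=
  ∑ᶠ c : M, ∫ y in (extChartAt (𝓡 n) c).target,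
    ((chartPartition n M c ((extChartAt (𝓡 n) c).symm y) * |chartDensity ε c y| : ℝ) : ℂ) *
      f ((extChartAt (𝓡 n) c).symm y)

end Forms

/-! ### Bivector fields -/

section Bivectors

variable {n : ℕ} {M : Type*} [TopologicalSpace M] [ChartedSpace (EuclideanSpace ℝ (Fin n)) M]

variable (n) in
/-- A complex bivector at `x`, i.e. an element of `Λ²(T_x M ⊗ ℂ)`, as an alternating `ℂ`-bilinear
form on the space of complex covectors at `x`. -/
abbrev BivectorAt (x : M) : Type _ :=
  (TangentSpace (𝓡 n) x →L[ℝ] ℂ) [⋀^Fin 2]→ₗ[ℂ] ℂ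

/-- The differential at `x` of a complex-valued function, as a complex covector. -/
def differential (f : M → ℂ) (x : M) : TangentSpace (𝓡 n) x →L[ℝ] ℂ :=
  mfderiv (𝓡 n) 𝓘(ℝ, ℂ) f x

/-- The covector `dxⁱ` at `x`, for the coordinates of the preferred chart at `x₀`. -/
def coordCovector (x₀ : M) (i : Fin n) (x : M) : TangentSpace (𝓡 n) x →L[ℝ] ℂ :=
  differential (n := n) (fun p => ((extChartAt (𝓡 n) x₀ p i : ℝ) : ℂ)) x

/-- The component `π^{ij} = π(dxⁱ, dxʲ)` at `x`, for the coordinates of the chart at `x₀`. -/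
def component (π : ∀ x : M, BivectorAt n x) (x₀ : M) (i j : Fin n) (x : M) : ℂ :=
  π x ![coordCovector x₀ i x, coordCovector x₀ j x]

/-- Smoothness of a bivector field: its components in charts are smooth. -/
def IsSmoothBivector (π : ∀ x : M, BivectorAt n x) : Prop :=
  ∀ (x₀ : M) (i j : Fin n),
    ContDiffOn ℝ ∞ (fun y => component π x₀ i j ((extChartAt (𝓡 n) x₀).symm y))
      (extChartAt (𝓡 n) x₀).target

/-- Contraction of a bivector on `ℝᵈ` into a real alternating `k`-form:
`(π ⌟ α)_{ij⋯} = ½ π^{ab} α_{abij⋯}`. It vanishes if `k < 2`. -/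
def contractLinear {d : ℕ} (π : (EuclideanSpace ℝ (Fin d) →L[ℝ] ℂ) [⋀^Fin 2]→ₗ[ℂ] ℂ) :
    {k : ℕ} → (EuclideanSpace ℝ (Fin d) [⋀^Fin k]→L[ℝ] ℝ) →
      EuclideanSpace ℝ (Fin d) [⋀^Fin (k - 2)]→L[ℝ] ℂ
  | 0, _ => 0
  | 1, _ => 0
  | _ + 2, α =>
    ∑ a : Fin d, ∑ b : Fin d,
      ((1 / 2 : ℂ) * π ![Complex.ofRealCLM ∘L EuclideanSpace.proj a,
        Complex.ofRealCLM ∘L EuclideanSpace.proj b]) •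
      Complex.ofRealCLM.compContinuousAlternatingMap
        ((α.curryLeft (EuclideanSpace.single a 1)).curryLeft (EuclideanSpace.single b 1))

/-- The `(n-2)`-form `π ⌟ ε`; indices refer to the basis of `T_x M = ℝⁿ` given by the preferred
chart at `x`, but the contraction does not depend on the basis. -/
def contract (π : ∀ x : M, BivectorAt n x) (ε : ∀ x : M, TangentSpace (𝓡 n) x [⋀^Fin n]→L[ℝ] ℝ)
    (x : M) : TangentSpace (𝓡 n) x [⋀^Fin (n - 2)]→L[ℝ] ℂ :=
  contractLinear (d := n) (π x) (ε x)

/-- `π` is the Poisson bivector field of the deformation: it is smooth and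
`{f, g} = π(df, dg)` for all `f, g ∈ C_c^∞(M)`. -/
def IsPoissonField {𝕜 A : Type*} [CommRing 𝕜] [Algebra ℂ 𝕜] [NonUnitalRing A] [Module 𝕜 A]
    [IsScalarTower 𝕜 A A] [SMulCommClass 𝕜 A A] [Module ℂ A] [IsScalarTower ℂ 𝕜 A]
    (D : SmoothDeformation n M 𝕜 A) (π : ∀ x : M, BivectorAt n x) : Prop :=
  IsSmoothBivector π ∧ ∀ (f g : SmoothCompact n M) (x : M),
    (D.bracket f g : M → ℂ) x =
      π x ![differential (f : M → ℂ) x, differential (g : M → ℂ) x]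

end Bivectors

/-! ### Connections -/

section Connections

variable {n : ℕ} {M : Type*} [TopologicalSpace M] [ChartedSpace (EuclideanSpace ℝ (Fin n)) M]
  [IsManifold (𝓡 n) ∞ M]

variable (n M) in
/-- Connections on the tangent bundle of `M`. The derivative `∇_v Y` of the vector field `Y` in
direction `v ∈ T_x M` is `cov Y x v`. -/
abbrev AffineConnection : Type _ :=
  CovariantDerivative (𝓡 n) (EuclideanSpace ℝ (Fin n)) (TangentSpace (𝓡 n) : M → Type _)

/-- `∇ε = 0`: for all smooth vector fields `Y₁, …, Yₙ` and all tangent vectors `v`,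
`v(ε(Y₁, …, Yₙ)) = ∑ᵢ ε(Y₁, …, ∇_v Yᵢ, …, Yₙ)`. -/
def IsParallel (cov : AffineConnection n M)
    (ε : ∀ x : M, TangentSpace (𝓡 n) x [⋀^Fin n]→L[ℝ] ℝ) : Prop :=
  ∀ Y : Fin n → ∀ x : M, TangentSpace (𝓡 n) x,
    (∀ i, ContMDiff (𝓡 n) (𝓡 n).tangent ∞
      (fun x => (⟨x, Y i x⟩ : TangentBundle (𝓡 n) M))) →
    ∀ (x : M) (v : TangentSpace (𝓡 n) x),
      (mfderiv (𝓡 n) 𝓘(ℝ, ℝ) (fun p => ε p (fun i => Y i p)) x v : ℝ) =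
        ∑ i, ε x (Function.update (fun j => Y j x) i (cov (Y i) x v))

/-- The coordinate vector field `∂_l` of the preferred chart at `x₀` (on the chart domain). -/
def coordField (x₀ : M) (l : Fin n) (x : M) : TangentSpace (𝓡 n) x :=
  (mfderiv (𝓡 n) 𝓘(ℝ, EuclideanSpace ℝ (Fin n)) (extChartAt (𝓡 n) x₀) x).inverse
    (EuclideanSpace.single l (1 : ℝ) : EuclideanSpace ℝ (Fin n))

/-- The Christoffel symbol `Γ^i_{kl} = dxⁱ(∇_{∂_k} ∂_l)` at `x`, in the chart at `x₀`. -/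
def christoffel (cov : AffineConnection n M) (x₀ : M) (i k l : Fin n) (x : M) : ℂ :=
  coordCovector x₀ i x (cov (coordField x₀ l) x (coordField x₀ k x))

/-- The component `∇_k π^{ij} = ∂_k π^{ij} + Γ^i_{kl} π^{lj} + Γ^j_{kl} π^{il}` at `x`, in the chart
at `x₀`. -/
def covDerivComponent (cov : AffineConnection n M) (π : ∀ x : M, BivectorAt n x) (x₀ : M)
    (k i j : Fin n) (x : M) : ℂ :=
  fderiv ℝ (fun y => component π x₀ i j ((extChartAt (𝓡 n) x₀).symm y))
      (extChartAt (𝓡 n) x₀ x) (EuclideanSpace.single k 1) +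
    ∑ l, (christoffel cov x₀ i k l x * component π x₀ l j x +
      christoffel cov x₀ j k l x * component π x₀ i l x)

/-- The bivector field `π` has zero divergence: `∑_j ∇_j π^{ij} = 0` in every chart. -/
def IsDivergenceFree (cov : AffineConnection n M) (π : ∀ x : M, BivectorAt n x) : Prop :=
  ∀ (x₀ : M), ∀ x ∈ (extChartAt (𝓡 n) x₀).source, ∀ i : Fin n,
    ∑ j, covDerivComponent cov π x₀ j i j x = 0

end Connections

end NCDeformation

end

/-! In a chart write `ε = ρ dx¹ ∧ ⋯ ∧ dxⁿ`. Everything passes through the equation `∑ⱼ ∂ⱼ(ρ π^{ij})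
= 0` (`chartDivergence`): the trace forces it, and both conditions on `π` are equivalent to it.

The commutator of `A` obeys the Leibniz rule in each argument, hence so does the bracket. By
Hadamard's lemma a derivation at a point kills every function whose differential vanishes there
(`derivation_eq_zero`), so `{f, g}(x)` depends only on `df` and `dg` at `x`. This gives the bivector
field, `existsUnique_isPoissonField`.

Next, `∫ {f, g} ε = 0` (`integral_bracket`). Let `c` lift `{f, g}` with `κ c = i[a, b]`, and let `I`
be the integral. The trace gives `κ τ(c) = 0`, but `𝕜` may have `κ`-torsion, so `κ` cannot be
cancelled there. Instead write `τ(c) = I - κ s`; then `κ I = κ² s`, and acting on `c` gives `κ (I c)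
∈ κ² A`. Freeness of `A / κ³ A` now yields `I c ∈ κ A`, that is `I {f, g} = 0`, which is impossible
for `I ≠ 0`.

Taking for `f` a coordinate `xⁱ` near the support of `g`, the vanishing integral reads `∫ ρ π^{ij}
∂ⱼg = 0` up to a sign, and integration by parts gives the divergence equation
(`chartDivergence_eq_zero_of_integral`).

The rest is calculus in charts. The coefficients of `d(π ⌟ ε)` are the numbers `∑ⱼ ∂ⱼ(ρ π^{ij})` up
to sign (`extDeriv_contraction_eq_zero_iff`), and `∑ⱼ ∂ⱼ(ρ π^{ij}) = ρ ∑ⱼ ∇ⱼπ^{ij}` for a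
torsion-free connection preserving `ε` (`sum_covDerivComponent`). -/

noncomputable section

namespace NCDeformation

open Set Filter Topology MeasureTheory

/-! ### Charts, transition maps and pullback of forms -/

section ChartBasics

variable {n : ℕ} {M : Type*} [TopologicalSpace M] [ChartedSpace (EuclideanSpace ℝ (Fin n)) M]

theorem isOpen_chartTarget (x₀ : M) : IsOpen (extChartAt (𝓡 n) x₀).target :=
  isOpen_extChartAt_target x₀

/-- The transition map from the preferred chart at `x₁` to the preferred chart at `x₀`. -/
def transition (n : ℕ) {M : Type*} [TopologicalSpace M]
    [ChartedSpace (EuclideanSpace ℝ (Fin n)) M] (x₀ x₁ : M) (y : EuclideanSpace ℝ (Fin n)) :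
    EuclideanSpace ℝ (Fin n) :=
  extChartAt (𝓡 n) x₀ ((extChartAt (𝓡 n) x₁).symm y)

/-- The domain of the transition map. -/
def overlap (n : ℕ) {M : Type*} [TopologicalSpace M]
    [ChartedSpace (EuclideanSpace ℝ (Fin n)) M] (x₀ x₁ : M) : Set (EuclideanSpace ℝ (Fin n)) :=
  (extChartAt (𝓡 n) x₁).target ∩ (extChartAt (𝓡 n) x₁).symm ⁻¹' (extChartAt (𝓡 n) x₀).source

theorem isOpen_overlap (x₀ x₁ : M) : IsOpen (overlap n x₀ x₁) :=
  (continuousOn_extChartAt_symm x₁).isOpen_inter_preimage (isOpen_chartTarget x₁)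
    (isOpen_extChartAt_source x₀)

variable [IsManifold (𝓡 n) ∞ M]

theorem contMDiffAt_chart {x₀ x : M} (hx : x ∈ (extChartAt (𝓡 n) x₀).source) :
    ContMDiffAt (𝓡 n) 𝓘(ℝ, EuclideanSpace ℝ (Fin n)) ∞ (extChartAt (𝓡 n) x₀) x :=
  contMDiffAt_extChartAt' (by rwa [extChartAt_source] at hx)

theorem contMDiffAt_chart_symm {x₀ : M} {y : EuclideanSpace ℝ (Fin n)}
    (hy : y ∈ (extChartAt (𝓡 n) x₀).target) :
    ContMDiffAt 𝓘(ℝ, EuclideanSpace ℝ (Fin n)) (𝓡 n) ∞ (extChartAt (𝓡 n) x₀).symm y :=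
  (contMDiffOn_extChartAt_symm x₀).contMDiffAt ((isOpen_chartTarget x₀).mem_nhds hy)

theorem mdifferentiableAt_chart {x₀ x : M} (hx : x ∈ (extChartAt (𝓡 n) x₀).source) :
    MDifferentiableAt (𝓡 n) 𝓘(ℝ, EuclideanSpace ℝ (Fin n)) (extChartAt (𝓡 n) x₀) x :=
  (contMDiffAt_chart hx).mdifferentiableAt (by simp)

theorem mdifferentiableAt_chart_symm {x₀ : M} {y : EuclideanSpace ℝ (Fin n)}
    (hy : y ∈ (extChartAt (𝓡 n) x₀).target) :
    MDifferentiableAt 𝓘(ℝ, EuclideanSpace ℝ (Fin n)) (𝓡 n) (extChartAt (𝓡 n) x₀).symm y :=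
  (contMDiffAt_chart_symm hy).mdifferentiableAt (by simp)

theorem mfderiv_chart_comp_symm {x₀ : M} {y : EuclideanSpace ℝ (Fin n)}
    (hy : y ∈ (extChartAt (𝓡 n) x₀).target) :
    (mfderiv (𝓡 n) 𝓘(ℝ, EuclideanSpace ℝ (Fin n)) (extChartAt (𝓡 n) x₀)
        ((extChartAt (𝓡 n) x₀).symm y)) ∘L
      (mfderiv 𝓘(ℝ, EuclideanSpace ℝ (Fin n)) (𝓡 n) (extChartAt (𝓡 n) x₀).symm y) =
      ContinuousLinearMap.id ℝ (EuclideanSpace ℝ (Fin n)) := by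
  have h := mfderiv_extChartAt_comp_mfderivWithin_extChartAt_symm (I := 𝓡 n) hy
  rw [ModelWithCorners.range_eq_univ, mfderivWithin_univ] at h
  exact h

theorem mfderiv_chart_symm_comp {x₀ x : M} (hx : x ∈ (extChartAt (𝓡 n) x₀).source) :
    (mfderiv 𝓘(ℝ, EuclideanSpace ℝ (Fin n)) (𝓡 n) (extChartAt (𝓡 n) x₀).symm
        (extChartAt (𝓡 n) x₀ x)) ∘L
      (mfderiv (𝓡 n) 𝓘(ℝ, EuclideanSpace ℝ (Fin n)) (extChartAt (𝓡 n) x₀) x) =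
      ContinuousLinearMap.id ℝ (TangentSpace (𝓡 n) x) := by
  have h := mfderivWithin_extChartAt_symm_comp_mfderiv_extChartAt' (I := 𝓡 n) hx
  rw [ModelWithCorners.range_eq_univ, mfderivWithin_univ] at h
  exact h

theorem contDiffAt_transition {x₀ x₁ : M} {y : EuclideanSpace ℝ (Fin n)}
    (hy : y ∈ overlap n x₀ x₁) : ContDiffAt ℝ ∞ (transition n x₀ x₁) y :=
  ((contMDiffAt_chart hy.2).comp y (contMDiffAt_chart_symm hy.1)).contDiffAt

theorem fderiv_transition {x₀ x₁ : M} {y : EuclideanSpace ℝ (Fin n)}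
    (hy : y ∈ overlap n x₀ x₁) : fderiv ℝ (transition n x₀ x₁) y =
      (mfderiv (𝓡 n) 𝓘(ℝ, EuclideanSpace ℝ (Fin n)) (extChartAt (𝓡 n) x₀)
        ((extChartAt (𝓡 n) x₁).symm y)) ∘L
      (mfderiv 𝓘(ℝ, EuclideanSpace ℝ (Fin n)) (𝓡 n) (extChartAt (𝓡 n) x₁).symm y) := by
  rw [← mfderiv_eq_fderiv]
  exact mfderiv_comp y (mdifferentiableAt_chart hy.2) (mdifferentiableAt_chart_symm hy.1)

variable {F : Type*} [NormedAddCommGroup F] [NormedSpace ℝ F] {k : ℕ}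

theorem chartForm_transition (α : ∀ x : M, TangentSpace (𝓡 n) x [⋀^Fin k]→L[ℝ] F) {x₀ x₁ : M}
    {y : EuclideanSpace ℝ (Fin n)} (hy : y ∈ overlap n x₀ x₁) :
    chartForm α x₁ y = (chartForm α x₀ (transition n x₀ x₁ y)).compContinuousLinearMap
      (fderiv ℝ (transition n x₀ x₁) y) := by
  have h0 : (extChartAt (𝓡 n) x₀).symm (transition n x₀ x₁ y) = (extChartAt (𝓡 n) x₁).symm y :=
    (extChartAt (𝓡 n) x₀).left_inv hy.2
  have h1 := mfderiv_chart_symm_comp hy.2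
  rw [fderiv_transition hy]
  unfold chartForm
  ext v
  -- The two base points are only propositionally equal and their tangent spaces depend on them, so
  -- the point is generalised before substituting.
  have h2 : ∀ (p : M) (hp : p = (extChartAt (𝓡 n) x₁).symm y), (α p) (fun i =>
      (mfderiv 𝓘(ℝ, EuclideanSpace ℝ (Fin n)) (𝓡 n) (extChartAt (𝓡 n) x₀).symm
        (extChartAt (𝓡 n) x₀ ((extChartAt (𝓡 n) x₁).symm y)))
        (((mfderiv (𝓡 n) 𝓘(ℝ, EuclideanSpace ℝ (Fin n)) (extChartAt (𝓡 n) x₀)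
        ((extChartAt (𝓡 n) x₁).symm y)) ∘L
      (mfderiv 𝓘(ℝ, EuclideanSpace ℝ (Fin n)) (𝓡 n) (extChartAt (𝓡 n) x₁).symm y)) (v i))) =
      α ((extChartAt (𝓡 n) x₁).symm y) (fun i =>
        mfderiv 𝓘(ℝ, EuclideanSpace ℝ (Fin n)) (𝓡 n) (extChartAt (𝓡 n) x₁).symm y (v i)) := by
    rintro p rfl
    congr 1
    ext1 i
    exact DFunLike.congr_fun h1 _
  exact (h2 _ h0).symm

/-- Vanishing of the exterior derivative can be tested in any chart. -/
theorem exteriorDerivative_eq_zero_iff (α : ∀ x : M, TangentSpace (𝓡 n) x [⋀^Fin k]→L[ℝ] F)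
    {x₀ x : M} (hx : x ∈ (extChartAt (𝓡 n) x₀).source)
    (hα : DifferentiableAt ℝ (chartForm α x₀) (extChartAt (𝓡 n) x₀ x)) :
    exteriorDerivative α x = 0 ↔
      extDeriv (chartForm α x₀) (extChartAt (𝓡 n) x₀ x) = 0 := by
  have hxx : x ∈ (extChartAt (𝓡 n) x).source := mem_extChartAt_source x
  have hinv : (extChartAt (𝓡 n) x).symm (extChartAt (𝓡 n) x x) = x :=
    (extChartAt (𝓡 n) x).left_inv hxx
  have hy : extChartAt (𝓡 n) x x ∈ overlap n x₀ x :=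
    ⟨mem_extChartAt_target x, by rw [mem_preimage, hinv]; exact hx⟩
  have ht : transition n x₀ x (extChartAt (𝓡 n) x x) = extChartAt (𝓡 n) x₀ x := by
    rw [transition, hinv]
  have e1 : chartForm α x =ᶠ[𝓝 (extChartAt (𝓡 n) x x)] fun y =>
      (chartForm α x₀ (transition n x₀ x y)).compContinuousLinearMap
        (fderiv ℝ (transition n x₀ x) y) :=
    Filter.eventuallyEq_of_mem ((isOpen_overlap x₀ x).mem_nhds hy)
      fun y hy => chartForm_transition α hy
  -- Since `d` commutes with pullback by the transition map, the value computed in the chart at `x`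
  -- is the pullback, by the derivative of the chart at `x₀`, of the one computed there. That
  -- derivative is invertible, so both vanish together.
  have e2 : exteriorDerivative α x = (extDeriv (chartForm α x₀)
      (extChartAt (𝓡 n) x₀ x)).compContinuousLinearMap
        (mfderiv (𝓡 n) 𝓘(ℝ, EuclideanSpace ℝ (Fin n)) (extChartAt (𝓡 n) x₀) x) := by
    unfold exteriorDerivative
    rw [e1.extDeriv_eq, extDeriv_pullback (by rwa [ht]) (contDiffAt_transition hy)
      (by rw [minSmoothness_of_isRCLikeNormedField]; norm_cast), ht, fderiv_transition hy]
    ext v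
    refine congrArg (extDeriv (chartForm α x₀) (extChartAt (𝓡 n) x₀ x)) (funext fun i => ?_)
    have := DFunLike.congr_fun (mfderiv_chart_symm_comp hxx) (v i)
    have h3 : ∀ (p : M) (hp : p = x) (w : TangentSpace (𝓡 n) x),
        (mfderiv (𝓡 n) 𝓘(ℝ, EuclideanSpace ℝ (Fin n)) (extChartAt (𝓡 n) x₀) p :
          EuclideanSpace ℝ (Fin n) → EuclideanSpace ℝ (Fin n)) w =
        mfderiv (𝓡 n) 𝓘(ℝ, EuclideanSpace ℝ (Fin n)) (extChartAt (𝓡 n) x₀) x w := by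
      rintro p rfl w; rfl
    refine (h3 _ hinv _).trans ?_
    exact congrArg _ this
  rw [e2]
  constructor
  · intro h
    ext v
    have h1 := DFunLike.congr_fun h (fun i => mfderiv 𝓘(ℝ, EuclideanSpace ℝ (Fin n)) (𝓡 n)
      (extChartAt (𝓡 n) x₀).symm (extChartAt (𝓡 n) x₀ x) (v i))
    have h2 := mfderiv_chart_comp_symm ((extChartAt (𝓡 n) x₀).map_source hx)
    rw [(extChartAt (𝓡 n) x₀).left_inv hx] at h2
    refine Eq.trans ?_ h1
    refine congrArg (extDeriv (chartForm α x₀) (extChartAt (𝓡 n) x₀ x)) (funext fun i => ?_)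
    exact (DFunLike.congr_fun h2 (v i)).symm
  · intro h
    rw [h]
    rfl

end ChartBasics

/-! ### Algebra of the bracket, and the trace -/

section BracketAlgebra

set_option linter.unusedSectionVars false

variable {n : ℕ} {M : Type*} [TopologicalSpace M] [ChartedSpace (EuclideanSpace ℝ (Fin n)) M]
  {𝕜 A : Type*} [CommRing 𝕜] [Algebra ℂ 𝕜] [NonUnitalRing A] [Module 𝕜 A]
  [IsScalarTower 𝕜 A A] [SMulCommClass 𝕜 A A] [Module ℂ A] [IsScalarTower ℂ 𝕜 A]

namespace SmoothDeformation

variable (D : SmoothDeformation n M 𝕜 A)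

theorem reduce_add (a b : A) : D.reduce (a + b) = D.reduce a + D.reduce b := by
  simp [reduce]

theorem reduce_smul (z : ℂ) (a : A) : D.reduce (z • a) = z • D.reduce a := by
  rw [reduce, reduce, ← map_smul, Submodule.Quotient.mk_smul]

theorem reduce_mul (a b : A) : D.reduce (a * b) = D.reduce a * D.reduce b :=
  D.classical_mul a b

theorem reduce_zero : D.reduce 0 = 0 := by simp [reduce]

/-- Commutators are exactly divisible by `κ`, so the slack modulo `κ²` in the definition is never
needed. The algebraic laws of the bracket then follow from exact commutator identities in `A`. -/
theorem bracket_reduce {a b c : A} (h : D.κ • c = a * b - b * a) :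
    D.bracket (D.reduce a) (D.reduce b) = D.reduce (Complex.I • c) := by
  refine ((D.existsUnique_isBracket (D.reduce a) (D.reduce b)).choose_spec.1.2
    a b _ rfl rfl ?_).symm
  rw [smul_comm, h, sub_self]
  exact zero_mem _

theorem bracket_self (f : SmoothCompact n M) : D.bracket f f = 0 := by
  obtain ⟨a, rfl⟩ := D.reduce_surjective f
  rw [D.bracket_reduce (c := 0) (by simp), smul_zero, D.reduce_zero]

theorem bracket_add_right (f g h : SmoothCompact n M) :
    D.bracket f (g + h) = D.bracket f g + D.bracket f h := by
  obtain ⟨a, rfl⟩ := D.reduce_surjective f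
  obtain ⟨b, rfl⟩ := D.reduce_surjective g
  obtain ⟨c, rfl⟩ := D.reduce_surjective h
  obtain ⟨p, hp⟩ := D.commutator a b
  obtain ⟨q, hq⟩ := D.commutator a c
  rw [← D.reduce_add, D.bracket_reduce hp, D.bracket_reduce hq,
    D.bracket_reduce (c := p + q) (by rw [smul_add, hp, hq, mul_add, add_mul]; abel),
    smul_add, D.reduce_add]

theorem bracket_add_left (f g h : SmoothCompact n M) :
    D.bracket (f + g) h = D.bracket f h + D.bracket g h := by
  obtain ⟨a, rfl⟩ := D.reduce_surjective f
  obtain ⟨b, rfl⟩ := D.reduce_surjective g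
  obtain ⟨c, rfl⟩ := D.reduce_surjective h
  obtain ⟨p, hp⟩ := D.commutator a c
  obtain ⟨q, hq⟩ := D.commutator b c
  rw [← D.reduce_add, D.bracket_reduce hp, D.bracket_reduce hq,
    D.bracket_reduce (c := p + q) (by rw [smul_add, hp, hq, mul_add, add_mul]; abel),
    smul_add, D.reduce_add]

theorem bracket_anticomm (f g : SmoothCompact n M) : D.bracket f g = - D.bracket g f := by
  have h := D.bracket_self (f + g)
  rw [D.bracket_add_left, D.bracket_add_right, D.bracket_add_right, D.bracket_self,
    D.bracket_self, zero_add, add_zero] at h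
  exact eq_neg_of_add_eq_zero_left h

theorem smul_comm_of_isScalarTower (z : ℂ) (r : 𝕜) (a : A) : r • z • a = z • r • a := by
  rw [← algebraMap_smul 𝕜 z a, ← algebraMap_smul 𝕜 z (r • a), smul_comm]

theorem bracket_smul_right (z : ℂ) (f g : SmoothCompact n M) :
    D.bracket f (z • g) = z • D.bracket f g := by
  obtain ⟨a, rfl⟩ := D.reduce_surjective f
  obtain ⟨b, rfl⟩ := D.reduce_surjective g
  obtain ⟨p, hp⟩ := D.commutator a b
  rw [← D.reduce_smul, D.bracket_reduce hp, D.bracket_reduce (c := z • p) (by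
    rw [smul_comm_of_isScalarTower, hp, smul_sub, ← algebraMap_smul 𝕜 z, ← algebraMap_smul 𝕜 z,
      ← algebraMap_smul 𝕜 z, mul_smul_comm, smul_mul_assoc]), smul_comm, D.reduce_smul]

theorem bracket_smul_left (z : ℂ) (f g : SmoothCompact n M) :
    D.bracket (z • f) g = z • D.bracket f g := by
  rw [D.bracket_anticomm, D.bracket_smul_right, D.bracket_anticomm f, smul_neg]

/-- The identity `[a, bc] = [a, b]c + b[a, c]` is exact in `A`, so `p * c + b * q` is the quotient
by `κ` of the new commutator. -/
theorem bracket_mul_right (f g h : SmoothCompact n M) :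
    D.bracket f (g * h) = D.bracket f g * h + g * D.bracket f h := by
  obtain ⟨a, rfl⟩ := D.reduce_surjective f
  obtain ⟨b, rfl⟩ := D.reduce_surjective g
  obtain ⟨c, rfl⟩ := D.reduce_surjective h
  obtain ⟨p, hp⟩ := D.commutator a b
  obtain ⟨q, hq⟩ := D.commutator a c
  have key : D.κ • (p * c + b * q) = a * (b * c) - b * c * a := by
    rw [smul_add, ← smul_mul_assoc, ← mul_smul_comm, hp, hq]
    simp only [mul_sub, sub_mul, mul_assoc]
    abel
  rw [← D.reduce_mul, D.bracket_reduce hp, D.bracket_reduce hq, D.bracket_reduce key,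
    D.reduce_smul, D.reduce_smul, D.reduce_smul, D.reduce_add, D.reduce_mul, D.reduce_mul,
    smul_add, smul_mul_assoc, mul_smul_comm]

variable [IsManifold (𝓡 n) ∞ M] [T2Space M] [SigmaCompactSpace M]

/-- A trace deforming the integral forces the integral of a Poisson bracket to vanish. -/
theorem integral_bracket (ε : ∀ x : M, TangentSpace (𝓡 n) x [⋀^Fin n]→L[ℝ] ℝ)
    (τ : A →ₗ[𝕜] 𝕜) (hτ : ∀ a b : A, τ (a * b) = τ (b * a))
    (hτε : ∀ a : A, algebraMap ℂ (𝕜 ⧸ Ideal.span {D.κ})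
        (integral ε (D.reduce a : M → ℂ)) = Ideal.Quotient.mk (Ideal.span {D.κ}) (τ a))
    (f g : SmoothCompact n M) : integral ε (D.bracket f g : M → ℂ) = 0 := by
  obtain ⟨a, rfl⟩ := D.reduce_surjective f
  obtain ⟨b, rfl⟩ := D.reduce_surjective g
  obtain ⟨p, hp⟩ := D.commutator a b
  rw [D.bracket_reduce hp]
  set c : A := Complex.I • p with hc
  by_contra hI
  set I₀ : ℂ := integral ε (D.reduce c : M → ℂ) with hI₀
  -- `κ c` is a multiple of a commutator, which `τ` kills. Since `κ` may be a zero divisor in `𝕜`,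
  -- this does not give `τ c = 0`.
  have h1 : D.κ * τ c = 0 := by
    rw [← smul_eq_mul, ← map_smul, hc, smul_comm_of_isScalarTower, hp,
      ← algebraMap_smul 𝕜 Complex.I, map_smul, map_sub, hτ a b, sub_self, smul_zero]
  have h2 : algebraMap ℂ 𝕜 I₀ - τ c ∈ Ideal.span {D.κ} := by
    rw [← Ideal.Quotient.eq]
    exact hτε c
  obtain ⟨s, hs⟩ := Ideal.mem_span_singleton'.1 h2
  -- By `h1` and `hs`, `κ I₀ = κ² s` in `𝕜`. Applying both sides to `c` moves the equation into `A`,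
  -- where freeness allows one `κ` to be cancelled.
  obtain ⟨e, he⟩ := D.exists_smul_eq_of_smul_eq (c := I₀ • c) (d := s • c) (by
    rw [← algebraMap_smul 𝕜 I₀ c, smul_smul, smul_smul]
    congr 1
    linear_combination h1 - D.κ * hs)
  have h3 : I₀ • D.reduce c = 0 := by
    rw [← D.reduce_smul, ← D.reduce_zero, D.reduce_eq_iff]
    exact ⟨e, by rw [he, sub_zero]⟩
  have h4 : D.reduce c = 0 := (smul_eq_zero.1 h3).resolve_left hI
  apply hI
  rw [hI₀, h4]
  simp [integral]

end SmoothDeformation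

end BracketAlgebra

/-! ### Transfer of test functions from a chart to the manifold -/

section ChartLift

variable {n : ℕ} {M : Type*} [TopologicalSpace M] [ChartedSpace (EuclideanSpace ℝ (Fin n)) M]

/-- Smooth functions on `ℝⁿ` with compact support in the target of the preferred chart at `x₀`. -/
structure IsChartTest (x₀ : M) (h : EuclideanSpace ℝ (Fin n) → ℂ) : Prop where
  contDiff : ContDiff ℝ ∞ h
  hasCompactSupport : HasCompactSupport h
  tsupport_subset : tsupport h ⊆ (extChartAt (𝓡 n) x₀).target

theorem IsChartTest.mul_left {x₀ : M} {h k : EuclideanSpace ℝ (Fin n) → ℂ}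
    (hh : IsChartTest x₀ h) (hk : ContDiff ℝ ∞ k) : IsChartTest x₀ (fun y => h y * k y) where
  contDiff := hh.contDiff.mul hk
  hasCompactSupport := hh.hasCompactSupport.mul_right
  tsupport_subset := (tsupport_mul_subset_left).trans hh.tsupport_subset

/-- The function on `M` which in the preferred chart at `x₀` is given by `h`. -/
def chartPush (x₀ : M) (h : EuclideanSpace ℝ (Fin n) → ℂ) : M → ℂ :=
  (extChartAt (𝓡 n) x₀).source.indicator (h ∘ extChartAt (𝓡 n) x₀)

/-- For every point there is a cutoff function in the chart, equal to `1` near the point. -/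
theorem exists_isChartTest (x₀ : M) {y₀ : EuclideanSpace ℝ (Fin n)}
    (hy₀ : y₀ ∈ (extChartAt (𝓡 n) x₀).target)
    {U : Set (EuclideanSpace ℝ (Fin n))} (hU : U ∈ 𝓝 y₀) :
    ∃ ψ : EuclideanSpace ℝ (Fin n) → ℂ, IsChartTest x₀ ψ ∧ tsupport ψ ⊆ U ∧ ψ =ᶠ[𝓝 y₀] 1 := by
  obtain ⟨r, hr, hrU⟩ := Metric.mem_nhds_iff.1
    (inter_mem hU ((isOpen_chartTarget x₀).mem_nhds hy₀))
  let b : ContDiffBump y₀ := ⟨r / 4, r / 2, by positivity, by linarith⟩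
  have hs : Function.support (fun y => ((b y : ℝ) : ℂ)) = Function.support b := by
    ext y; simp
  have ht : tsupport (fun y => ((b y : ℝ) : ℂ)) ⊆ U ∩ (extChartAt (𝓡 n) x₀).target := by
    rw [tsupport, hs]
    change tsupport b ⊆ _
    rw [b.tsupport_eq]
    exact (Metric.closedBall_subset_ball (by change r / 2 < r; linarith)).trans hrU
  refine ⟨fun y => ((b y : ℝ) : ℂ), ⟨Complex.ofRealCLM.contDiff.comp b.contDiff, ?_,
    ht.trans inter_subset_right⟩, ht.trans inter_subset_left, ?_⟩
  · rw [HasCompactSupport, tsupport, hs]; exact b.hasCompactSupport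
  · filter_upwards [b.eventuallyEq_one] with y hy
    simp [hy]

variable [IsManifold (𝓡 n) ∞ M] [T2Space M]

/-- The function in `C_c^∞(M)` which in the preferred chart at `x₀` is given by `h`. -/
def chartLift {x₀ : M} {h : EuclideanSpace ℝ (Fin n) → ℂ} (hh : IsChartTest x₀ h) :
    SmoothCompact n M :=
  ⟨chartPush x₀ h, by
    set K := (extChartAt (𝓡 n) x₀).symm '' tsupport h with hK
    have hKc : IsCompact K := hh.hasCompactSupport.isCompact.image_of_continuousOn
      ((continuousOn_extChartAt_symm x₀).mono hh.tsupport_subset)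
    have h0 : ∀ p ∉ K, chartPush x₀ h p = 0 := by
      intro p hp
      by_cases hps : p ∈ (extChartAt (𝓡 n) x₀).source
      · rw [chartPush, indicator_of_mem hps]
        by_contra hne
        exact hp ⟨_, subset_tsupport h hne, (extChartAt (𝓡 n) x₀).left_inv hps⟩
      · exact indicator_of_notMem hps _
    refine ⟨fun p => ?_, HasCompactSupport.intro hKc h0⟩
    by_cases hps : p ∈ (extChartAt (𝓡 n) x₀).source
    · refine (hh.contDiff.contMDiff.contMDiffAt.comp p
        (contMDiffAt_chart hps)).congr_of_eventuallyEq ?_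
      filter_upwards [(isOpen_extChartAt_source (I := 𝓡 n) x₀).mem_nhds hps] with q hq
      exact indicator_of_mem hq _
    -- Off the chart domain the function is locally zero: the compact set `K` is closed because `M`
    -- is Hausdorff, so its complement is a neighbourhood of `p`.
    · have hpK : p ∉ K := by
        rintro ⟨y, hy, rfl⟩
        exact hps ((extChartAt (𝓡 n) x₀).map_target (hh.tsupport_subset hy))
      refine (contMDiffAt_const (c := (0 : ℂ))).congr_of_eventuallyEq ?_
      filter_upwards [hKc.isClosed.isOpen_compl.mem_nhds hpK] with q hq
      exact h0 q hq⟩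

theorem chartLift_of_mem {x₀ p : M} {h : EuclideanSpace ℝ (Fin n) → ℂ} (hh : IsChartTest x₀ h)
    (hp : p ∈ (extChartAt (𝓡 n) x₀).source) :
    (chartLift hh : M → ℂ) p = h (extChartAt (𝓡 n) x₀ p) :=
  indicator_of_mem hp _

theorem chartLift_of_notMem {x₀ p : M} {h : EuclideanSpace ℝ (Fin n) → ℂ}
    (hh : IsChartTest x₀ h) (hp : p ∉ (extChartAt (𝓡 n) x₀).source) :
    (chartLift hh : M → ℂ) p = 0 :=
  indicator_of_notMem hp _

theorem differential_chartLift {x₀ p : M} {h : EuclideanSpace ℝ (Fin n) → ℂ}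
    (hh : IsChartTest x₀ h) (hp : p ∈ (extChartAt (𝓡 n) x₀).source) :
    differential (n := n) (chartLift hh : M → ℂ) p =
      (fderiv ℝ h (extChartAt (𝓡 n) x₀ p)) ∘L
        (mfderiv (𝓡 n) 𝓘(ℝ, EuclideanSpace ℝ (Fin n)) (extChartAt (𝓡 n) x₀) p) := by
  have he : (chartLift hh : M → ℂ) =ᶠ[𝓝 p] h ∘ extChartAt (𝓡 n) x₀ := by
    filter_upwards [(isOpen_extChartAt_source (I := 𝓡 n) x₀).mem_nhds hp] with q hq
    exact indicator_of_mem hq _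
  rw [differential, he.mfderiv_eq, mfderiv_comp p
    (hh.contDiff.contMDiff.mdifferentiableAt (by simp)) (mdifferentiableAt_chart hp),
    mfderiv_eq_fderiv]
  rfl

end ChartLift

/-! ### Hadamard's lemma -/

section Hadamard

variable {P F : Type*} [NormedAddCommGroup P] [NormedSpace ℝ P]
  [NormedAddCommGroup F] [NormedSpace ℝ F]

/-- Smooth dependence of an integral over `[0, 1]` on parameters. -/
theorem contDiff_intervalIntegral_param {G : P → ℝ → F}
    (hG : ContDiff ℝ ∞ (fun q : P × ℝ => G q.1 q.2)) :
    ContDiff ℝ ∞ (fun p => ∫ t in (0 : ℝ)..1, G p t) := by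
  -- The integral is the value at `0` of the convolution of the indicator of `[0, 1]` with the
  -- reflected function `t ↦ G p (-t)`. The cutoff `b`, equal to `1` on `[-2, 2]`, makes that
  -- function compactly supported without changing it where it is used, so smoothness of
  -- convolutions with parameters applies.
  let b : ContDiffBump (0 : ℝ) := ⟨2, 3, by norm_num, by norm_num⟩
  let g : P → ℝ → F := fun p t => b t • G p (-t)
  let f : ℝ → ℝ := (Icc (0 : ℝ) 1).indicator 1
  have hf : LocallyIntegrable f volume := by
    refine Integrable.locallyIntegrable ?_
    exact (integrable_indicator_iff measurableSet_Icc).2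
      (integrableOn_const (C := (1 : ℝ)) (by simp))
  have hg : ContDiffOn ℝ ∞ (fun q : P × ℝ => g q.1 q.2) (univ ×ˢ univ) := by
    refine ContDiff.contDiffOn ?_
    exact (b.contDiff.comp contDiff_snd).smul
      (hG.comp (contDiff_fst.prodMk contDiff_snd.neg))
  have hconv := contDiffOn_convolution_right_with_param (μ := volume) (n := ⊤)
    (ContinuousLinearMap.lsmul ℝ ℝ) (f := f) (g := g) (s := univ) (k := tsupport b) isOpen_univ
    b.hasCompactSupport.isCompact
    (fun p x _ hx => by simp [g, image_eq_zero_of_notMem_tsupport hx]) hf hg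
  have hc2 : ContDiff ℝ ∞ (fun p : P =>
      (convolution f (g p) (ContinuousLinearMap.lsmul ℝ ℝ) volume) 0) := by
    rw [univ_prod_univ, contDiffOn_univ] at hconv
    exact hconv.comp (contDiff_id.prodMk contDiff_const)
  convert hc2 using 2 with p
  rw [convolution_def, intervalIntegral.integral_of_le zero_le_one, ← integral_Icc_eq_integral_Ioc,
    ← integral_indicator measurableSet_Icc]
  congr 1
  ext t
  by_cases ht : t ∈ Icc (0 : ℝ) 1
  · have hb : b (0 - t) = 1 := b.one_of_mem_closedBall (by
      rw [mem_closedBall_zero_iff, Real.norm_eq_abs, abs_le]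
      change -2 ≤ 0 - t ∧ 0 - t ≤ 2
      constructor <;> linarith [ht.1, ht.2])
    simp only [f, indicator_of_mem ht, g, hb]
    simp
  · simp [f, indicator_of_notMem ht]

/-- Hadamard's lemma. -/
theorem exists_hadamard [CompleteSpace F] {g : P → F} (hg : ContDiff ℝ ∞ g) (x : P) :
    ∃ K : P → P →L[ℝ] F, ContDiff ℝ ∞ K ∧ K x = fderiv ℝ g x ∧
      ∀ y, g y = g x + K y (y - x) := by
  -- `K y` is the average of the derivative of `g` along the segment from `x` to `y`; the
  -- fundamental theorem of calculus on this segment gives the identity.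
  refine ⟨fun y => ∫ t in (0 : ℝ)..1, fderiv ℝ g (x + t • (y - x)), ?_, by simp, fun y => ?_⟩
  · apply contDiff_intervalIntegral_param
    exact (hg.fderiv_right (m := ∞) le_rfl).comp
      (contDiff_const.add (contDiff_snd.smul (contDiff_fst.sub contDiff_const)))
  · have hcont : Continuous fun t : ℝ => fderiv ℝ g (x + t • (y - x)) :=
      (hg.continuous_fderiv (by simp)).comp (by fun_prop)
    rw [ContinuousLinearMap.intervalIntegral_apply (hcont.intervalIntegrable _ _)]
    have hd : ∀ t ∈ uIcc (0 : ℝ) 1, HasDerivAt (fun t : ℝ => g (x + t • (y - x)))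
        (fderiv ℝ g (x + t • (y - x)) (y - x)) t := by
      intro t _
      have h1 : HasDerivAt (fun t : ℝ => x + t • (y - x)) (y - x) t := by
        simpa using ((hasDerivAt_id t).smul_const (y - x)).const_add x
      exact ((hg.differentiable (by simp)) _).hasFDerivAt.comp_hasDerivAt t h1
    rw [intervalIntegral.integral_eq_sub_of_hasDerivAt hd
      ((hcont.clm_apply continuous_const).intervalIntegrable _ _)]
    simp

end Hadamard

/-! ### Derivations at a point -/

section Derivations

theorem euclidean_eq_sum {n : ℕ} (v : EuclideanSpace ℝ (Fin n)) :
    v = ∑ i, v i • (EuclideanSpace.single i (1 : ℝ) : EuclideanSpace ℝ (Fin n)) := by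
  ext j; simp [Finset.sum_apply, Pi.single_apply]

variable {n : ℕ} {M : Type*} [TopologicalSpace M] [ChartedSpace (EuclideanSpace ℝ (Fin n)) M]
  [IsManifold (𝓡 n) ∞ M]

/-- Multiplying a function on `M` by a cutoff function in a chart gives a function in the chart. -/
theorem isChartTest_mul_comp_symm {x₀ : M} {ψ : EuclideanSpace ℝ (Fin n) → ℂ}
    (hψ : IsChartTest x₀ ψ) (g : SmoothCompact n M) :
    IsChartTest x₀ (fun y => ψ y * (g : M → ℂ) ((extChartAt (𝓡 n) x₀).symm y)) where
  contDiff := by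
    have key : ContMDiff 𝓘(ℝ, EuclideanSpace ℝ (Fin n)) 𝓘(ℝ, ℂ) ∞
        (fun y => ψ y * (g : M → ℂ) ((extChartAt (𝓡 n) x₀).symm y)) := by
      refine contMDiff_of_tsupport fun y hy => ?_
      have hy' : y ∈ (extChartAt (𝓡 n) x₀).target :=
        hψ.tsupport_subset (tsupport_mul_subset_left hy)
      have h1 : ContDiffAt ℝ ∞ (fun y => (g : M → ℂ) ((extChartAt (𝓡 n) x₀).symm y)) y :=
        (g.2.1.contMDiffAt.comp y (contMDiffAt_chart_symm hy')).contDiffAt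
      exact (hψ.contDiff.contDiffAt.mul h1).contMDiffAt
    exact key.contDiff
  hasCompactSupport := hψ.hasCompactSupport.mul_right
  tsupport_subset := (tsupport_mul_subset_left).trans hψ.tsupport_subset

variable [T2Space M]

/-- A derivation of `C_c^∞(M)` at a point only depends on differentials at that point. -/
theorem derivation_eq_zero {X : SmoothCompact n M →+ ℂ} {x : M}
    (hX : ∀ f g : SmoothCompact n M, X (f * g) = X f * (g : M → ℂ) x + (f : M → ℂ) x * X g)
    (hXs : ∀ (z : ℂ) (f : SmoothCompact n M), X (z • f) = z * X f)
    {g : SmoothCompact n M} (hg : differential (n := n) (g : M → ℂ) x = 0) : X g = 0 := by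
  set y₀ := extChartAt (𝓡 n) x x with hy₀
  have hx : x ∈ (extChartAt (𝓡 n) x).source := mem_extChartAt_source x
  have hinv : (extChartAt (𝓡 n) x).symm y₀ = x := (extChartAt (𝓡 n) x).left_inv hx
  have hyt : y₀ ∈ (extChartAt (𝓡 n) x).target := mem_extChartAt_target x
  obtain ⟨ψ, hψ, -, hψ1⟩ := exists_isChartTest x hyt univ_mem
  have hψy : ψ y₀ = 1 := hψ1.self_of_nhds
  have hψd : fderiv ℝ ψ y₀ = 0 := by
    rw [hψ1.fderiv_eq]; exact fderiv_const_apply 1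
  set Ψ := chartLift hψ with hΨ
  have hΨx : (Ψ : M → ℂ) x = 1 := by rw [hΨ, chartLift_of_mem hψ hx, ← hy₀, hψy]
  have hX0 : ∀ f g : SmoothCompact n M, (f : M → ℂ) x = 0 → (g : M → ℂ) x = 0 →
      X (f * g) = 0 := by
    intro f g hf hg; rw [hX, hf, hg]; ring
  -- The algebra has no unit, so it is not yet known that `X` kills a function that is constant near
  -- `x`. The terms in `X Ψ` are kept, and removed by applying this identity to `g = Ψ`.
  have key : ∀ g : SmoothCompact n M, differential (n := n) (g : M → ℂ) x = 0 →
      3 * X Ψ * (g : M → ℂ) x + X g = 2 * X Ψ * (g : M → ℂ) x := by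
    intro g hg
    set G : EuclideanSpace ℝ (Fin n) → ℂ :=
      fun y => ψ y * (g : M → ℂ) ((extChartAt (𝓡 n) x).symm y) with hG
    have hGt : IsChartTest x G := isChartTest_mul_comp_symm hψ g
    have hGx : G y₀ = (g : M → ℂ) x := by simp only [hG, hψy, hinv, one_mul]
    have hGd : fderiv ℝ G y₀ = 0 := by
      have h1 : G =ᶠ[𝓝 y₀] (g : M → ℂ) ∘ (extChartAt (𝓡 n) x).symm := by
        filter_upwards [hψ1] with y hy
        simp [hG, hy]
      have hgx : MDifferentiableAt (𝓡 n) 𝓘(ℝ, ℂ) (g : M → ℂ) ((extChartAt (𝓡 n) x).symm y₀) :=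
        ContMDiff.mdifferentiableAt g.2.1 (by simp)
      have hg' : mfderiv (𝓡 n) 𝓘(ℝ, ℂ) (g : M → ℂ) ((extChartAt (𝓡 n) x).symm y₀) = 0 := by
        rw [hinv]; exact hg
      rw [h1.fderiv_eq, ← mfderiv_eq_fderiv, mfderiv_comp y₀ hgx (mdifferentiableAt_chart_symm hyt),
        hg']
      rfl
    obtain ⟨K, hK, hKx, hKy⟩ := exists_hadamard hGt.contDiff y₀
    rw [hGd] at hKx
    let e : Fin n → EuclideanSpace ℝ (Fin n) := fun i => EuclideanSpace.single i 1
    have hu : ∀ i : Fin n, IsChartTest x fun y => ψ y * ((y i - y₀ i : ℝ) : ℂ) := fun i =>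
      hψ.mul_left (Complex.ofRealCLM.contDiff.comp
        ((EuclideanSpace.proj (𝕜 := ℝ) i).contDiff.sub contDiff_const))
    have hv : ∀ i : Fin n, IsChartTest x fun y => ψ y * K y (e i) := fun i =>
      hψ.mul_left (hK.clm_apply contDiff_const)
    -- Hadamard's expansion of `ψ g` about `y₀`, multiplied by `ψ²` so that the constant term and
    -- both factors of each product lie in `C_c^∞(M)`. All these factors vanish at `x`: the first
    -- ones through `y i - y₀ i`, the second ones because `K y₀ = 0`.
    have hid : Ψ * Ψ * Ψ * g = (g : M → ℂ) x • (Ψ * Ψ) +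
        ∑ i, chartLift (hu i) * chartLift (hv i) := by
      apply Subtype.ext
      funext p
      have hsum : ((∑ i, chartLift (hu i) * chartLift (hv i) : SmoothCompact n M) : M → ℂ) p =
          ∑ i, (chartLift (hu i) : M → ℂ) p * (chartLift (hv i) : M → ℂ) p := by
        have hcs := map_sum (NonUnitalSubalgebraClass.subtype (SmoothCompact n M))
          (fun i => chartLift (hu i) * chartLift (hv i)) Finset.univ
        exact (congrFun hcs p).trans (Finset.sum_apply _ _ _)
      change (Ψ : M → ℂ) p * (Ψ : M → ℂ) p * (Ψ : M → ℂ) p * (g : M → ℂ) p =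
        (g : M → ℂ) x * ((Ψ : M → ℂ) p * (Ψ : M → ℂ) p) +
        ((∑ i, chartLift (hu i) * chartLift (hv i) : SmoothCompact n M) : M → ℂ) p
      rw [hsum]
      by_cases hp : p ∈ (extChartAt (𝓡 n) x).source
      · rw [hΨ, chartLift_of_mem hψ hp]
        simp_rw [fun i => chartLift_of_mem (hu i) hp, fun i => chartLift_of_mem (hv i) hp]
        set y := extChartAt (𝓡 n) x p
        have hyp : (extChartAt (𝓡 n) x).symm y = p := (extChartAt (𝓡 n) x).left_inv hp
        have h2 : ψ y * (g : M → ℂ) p = (g : M → ℂ) x + K y (y - y₀) := by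
          rw [← hGx, ← hKy y, hG]
          simp only [hyp]
        have h3 : K y (y - y₀) = ∑ i, ((y i - y₀ i : ℝ) : ℂ) * K y (e i) := by
          have h4 : y - y₀ = ∑ i, (y i - y₀ i) • e i := euclidean_eq_sum _
          conv_lhs => rw [h4, map_sum]
          simp
        have h5 : ψ y * ψ y * ψ y * (g : M → ℂ) p = ψ y * ψ y * (ψ y * (g : M → ℂ) p) := by ring
        rw [h5, h2, h3, mul_add, Finset.mul_sum]
        congr 1
        · ring
        · exact Finset.sum_congr rfl fun i _ => by ring
      · rw [hΨ, chartLift_of_notMem hψ hp]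
        simp [chartLift_of_notMem _ hp]
    have hXid := congrArg X hid
    rw [map_add, map_sum, hXs] at hXid
    rw [Finset.sum_eq_zero (fun i _ => hX0 _ _
      (by rw [chartLift_of_mem (hu i) hx, ← hy₀]; simp)
      (by rw [chartLift_of_mem (hv i) hx, ← hy₀, hKx]; simp))] at hXid
    have c1 : ∀ f g : SmoothCompact n M, ((f * g : SmoothCompact n M) : M → ℂ) x =
      (f : M → ℂ) x * (g : M → ℂ) x := fun _ _ => rfl
    simp only [hX, c1, hΨx] at hXid
    linear_combination hXid
  have hΨd : differential (n := n) (Ψ : M → ℂ) x = 0 := by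
    rw [hΨ, differential_chartLift hψ hx, ← hy₀, hψd]; rfl
  -- With `Ψ x = 1` and `dΨ = 0` at `x`, `key` reads `3 X Ψ + X Ψ = 2 X Ψ`.
  have h0 : X Ψ = 0 := by
    have := key Ψ hΨd
    rw [hΨx] at this
    linear_combination this / 2
  have := key g hg
  rw [h0] at this
  linear_combination this

end Derivations

/-! ### Existence, smoothness and uniqueness of the Poisson bivector field -/

section PoissonField

variable {n : ℕ} {M : Type*} [TopologicalSpace M] [ChartedSpace (EuclideanSpace ℝ (Fin n)) M]

theorem differential_sub (f g : SmoothCompact n M) (x : M) :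
    differential (n := n) ((f - g : SmoothCompact n M) : M → ℂ) x =
      differential (n := n) (f : M → ℂ) x - differential (n := n) (g : M → ℂ) x :=
  mfderiv_sub (ContMDiff.mdifferentiableAt f.2.1 (by simp))
    (ContMDiff.mdifferentiableAt g.2.1 (by simp))

variable (n) in
/-- A cutoff function at `x` in the preferred chart at `x`. -/
def cutoff (x : M) : EuclideanSpace ℝ (Fin n) → ℂ :=
  (exists_isChartTest (n := n) x (mem_extChartAt_target x) univ_mem).choose

theorem isChartTest_cutoff (x : M) : IsChartTest x (cutoff n x) :=
  (exists_isChartTest (n := n) x (mem_extChartAt_target x) univ_mem).choose_spec.1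

theorem cutoff_eventuallyEq (x : M) : cutoff n x =ᶠ[𝓝 (extChartAt (𝓡 n) x x)] 1 :=
  (exists_isChartTest (n := n) x (mem_extChartAt_target x) univ_mem).choose_spec.2.2

variable [IsManifold (𝓡 n) ∞ M]

theorem coordCovector_eq {x₀ x : M} (hx : x ∈ (extChartAt (𝓡 n) x₀).source) (i : Fin n) :
    coordCovector x₀ i x = (Complex.ofRealCLM ∘L EuclideanSpace.proj i) ∘L
      (mfderiv (𝓡 n) 𝓘(ℝ, EuclideanSpace ℝ (Fin n)) (extChartAt (𝓡 n) x₀) x) := by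
  let L : EuclideanSpace ℝ (Fin n) →L[ℝ] ℂ := Complex.ofRealCLM ∘L EuclideanSpace.proj i
  have h := mfderiv_comp x (g := L) (L.mdifferentiableAt) (mdifferentiableAt_chart hx)
  rw [L.mfderiv_eq] at h
  exact h

variable [T2Space M]

variable {𝕜 A : Type*} [CommRing 𝕜] [Algebra ℂ 𝕜] [NonUnitalRing A] [Module 𝕜 A]
  [IsScalarTower 𝕜 A A] [SMulCommClass 𝕜 A A] [Module ℂ A] [IsScalarTower ℂ 𝕜 A]
  (D : SmoothDeformation n M 𝕜 A)

theorem bracket_eq_zero_of_differential (f : SmoothCompact n M) {g : SmoothCompact n M} {x : M}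
    (hg : differential (n := n) (g : M → ℂ) x = 0) : (D.bracket f g : M → ℂ) x = 0 := by
  let X : SmoothCompact n M →+ ℂ := AddMonoidHom.mk' (fun g => (D.bracket f g : M → ℂ) x)
    fun g h => by rw [D.bracket_add_right]; rfl
  refine derivation_eq_zero (X := X) (fun g h => ?_) (fun z g => ?_) hg
  · change (D.bracket f (g * h) : M → ℂ) x = _
    rw [D.bracket_mul_right]; rfl
  · change (D.bracket f (z • g) : M → ℂ) x = _
    rw [D.bracket_smul_right]; rfl

theorem bracket_congr_right (f : SmoothCompact n M) {g g' : SmoothCompact n M} {x : M}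
    (hg : differential (n := n) (g : M → ℂ) x = differential (n := n) (g' : M → ℂ) x) :
    (D.bracket f g : M → ℂ) x = (D.bracket f g' : M → ℂ) x := by
  have h0 := bracket_eq_zero_of_differential D f (g := g - g') (x := x)
    (by rw [differential_sub, hg, sub_self])
  have h1 : D.bracket f g = D.bracket f (g - g') + D.bracket f g' := by
    rw [← D.bracket_add_right, sub_add_cancel]
  rw [h1]
  change (D.bracket f (g - g') : M → ℂ) x + (D.bracket f g' : M → ℂ) x = _
  rw [h0, zero_add]

/-- The bracket at a point only depends on the differentials at that point. -/
theorem bracket_congr {f f' g g' : SmoothCompact n M} {x : M}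
    (hf : differential (n := n) (f : M → ℂ) x = differential (n := n) (f' : M → ℂ) x)
    (hg : differential (n := n) (g : M → ℂ) x = differential (n := n) (g' : M → ℂ) x) :
    (D.bracket f g : M → ℂ) x = (D.bracket f' g' : M → ℂ) x := by
  rw [bracket_congr_right D f hg, D.bracket_anticomm f, D.bracket_anticomm f']
  exact congrArg Neg.neg (bracket_congr_right D g' hf)

/-- A function with prescribed differential at `x`. -/
def primitiveAt (x : M) (α : TangentSpace (𝓡 n) x →L[ℝ] ℂ) : SmoothCompact n M :=
  chartLift ((isChartTest_cutoff x).mul_left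
    (k := (α : EuclideanSpace ℝ (Fin n) →L[ℝ] ℂ)) (ContinuousLinearMap.contDiff _))

theorem differential_chartLift_mul {x₀ x : M} {ψ : EuclideanSpace ℝ (Fin n) → ℂ}
    (hψ : IsChartTest x₀ ψ) (L : EuclideanSpace ℝ (Fin n) →L[ℝ] ℂ)
    (hx : x ∈ (extChartAt (𝓡 n) x₀).source) (h1 : ψ =ᶠ[𝓝 (extChartAt (𝓡 n) x₀ x)] 1) :
    differential (n := n) (chartLift (hψ.mul_left L.contDiff) : M → ℂ) x = L ∘L
      (mfderiv (𝓡 n) 𝓘(ℝ, EuclideanSpace ℝ (Fin n)) (extChartAt (𝓡 n) x₀) x) := by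
  rw [differential_chartLift _ hx]
  have he : (fun y => ψ y * L y) =ᶠ[𝓝 (extChartAt (𝓡 n) x₀ x)] L := by
    filter_upwards [h1] with y hy
    simp [hy]
  rw [he.fderiv_eq, L.fderiv]

theorem differential_primitiveAt (x : M) (α : TangentSpace (𝓡 n) x →L[ℝ] ℂ) :
    differential (n := n) (primitiveAt x α : M → ℂ) x = α := by
  refine (differential_chartLift_mul (isChartTest_cutoff x) _ (mem_extChartAt_source x)
    (cutoff_eventuallyEq x)).trans ?_
  -- The tangent space at `x` is the model space seen through the preferred chart at `x`, so this
  -- chart has identity derivative there.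
  rw [mfderiv_extChartAt_self]
  rfl

/-- The primitive is chosen linearly in the covector, so that bilinearity of the bracket passes
directly to `poissonField`. -/
theorem primitiveAt_add (x : M) (α β : TangentSpace (𝓡 n) x →L[ℝ] ℂ) :
    primitiveAt x (α + β) = primitiveAt x α + primitiveAt x β := by
  apply Subtype.ext
  funext p
  change (primitiveAt x (α + β) : M → ℂ) p =
    (primitiveAt x α : M → ℂ) p + (primitiveAt x β : M → ℂ) p
  unfold primitiveAt
  by_cases hp : p ∈ (extChartAt (𝓡 n) x).source
  · simp only [chartLift_of_mem _ hp]
    exact mul_add _ _ _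
  · simp only [chartLift_of_notMem _ hp, add_zero]

theorem primitiveAt_smul (x : M) (z : ℂ) (α : TangentSpace (𝓡 n) x →L[ℝ] ℂ) :
    primitiveAt x (z • α) = z • primitiveAt x α := by
  apply Subtype.ext
  funext p
  change (primitiveAt x (z • α) : M → ℂ) p = z • (primitiveAt x α : M → ℂ) p
  unfold primitiveAt
  by_cases hp : p ∈ (extChartAt (𝓡 n) x).source
  · simp only [chartLift_of_mem _ hp]
    exact mul_left_comm _ _ _
  · simp only [chartLift_of_notMem _ hp, smul_zero]

/-- The Poisson bivector field of a deformation. -/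
def poissonField (x : M) : BivectorAt n x where
  toFun v := (D.bracket (primitiveAt x (v 0)) (primitiveAt x (v 1)) : M → ℂ) x
  map_update_add' v i α β := by
    have h : i = 0 ∨ i = 1 := by omega
    rcases h with rfl | rfl <;>
      simp [Function.update, primitiveAt_add, D.bracket_add_left, D.bracket_add_right]
  map_update_smul' v i z α := by
    have h : i = 0 ∨ i = 1 := by omega
    rcases h with rfl | rfl <;>
      simp [Function.update, primitiveAt_smul, D.bracket_smul_left, D.bracket_smul_right]
  map_eq_zero_of_eq' v i j hv hij := by
    have h : v 0 = v 1 := by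
      have h : (i = 0 ∧ j = 1) ∨ (i = 1 ∧ j = 0) := by omega
      rcases h with ⟨rfl, rfl⟩ | ⟨rfl, rfl⟩
      exacts [hv, hv.symm]
    rw [h, D.bracket_self]
    rfl

theorem poissonField_apply (f g : SmoothCompact n M) (x : M) :
    poissonField D x ![differential (n := n) (f : M → ℂ) x, differential (n := n) (g : M → ℂ) x] =
      (D.bracket f g : M → ℂ) x :=
  bracket_congr D (differential_primitiveAt x _) (differential_primitiveAt x _)

/-- Near a given point the cut-off coordinates `ψ xⁱ` have differential `dxⁱ`, so `π^{ij}` agrees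
there with the smooth function `{ψ xⁱ, ψ xʲ}`. -/
theorem isSmoothBivector_of_bracket {π : ∀ x : M, BivectorAt n x}
    (hπ : ∀ (f g : SmoothCompact n M) (x : M), (D.bracket f g : M → ℂ) x =
      π x ![differential (f : M → ℂ) x, differential (g : M → ℂ) x]) : IsSmoothBivector π := by
  intro x₀ i j y hy
  obtain ⟨ψ, hψ, -, h1⟩ := exists_isChartTest x₀ hy univ_mem
  set L : Fin n → (EuclideanSpace ℝ (Fin n) →L[ℝ] ℂ) :=
    fun i => Complex.ofRealCLM ∘L EuclideanSpace.proj i with hL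
  set B := D.bracket (chartLift (hψ.mul_left (L i).contDiff))
    (chartLift (hψ.mul_left (L j).contDiff))
  have hB : ContDiffAt ℝ ∞ (fun y => (B : M → ℂ) ((extChartAt (𝓡 n) x₀).symm y)) y :=
    (ContMDiff.contMDiffAt B.2.1).comp y (contMDiffAt_chart_symm hy) |>.contDiffAt
  refine (hB.congr_of_eventuallyEq ?_).contDiffWithinAt
  filter_upwards [h1.eventually_nhds, (isOpen_chartTarget x₀).mem_nhds hy] with z hz hzt
  have hzs := (extChartAt (𝓡 n) x₀).map_target hzt
  have hz' : ψ =ᶠ[𝓝 (extChartAt (𝓡 n) x₀ ((extChartAt (𝓡 n) x₀).symm z))] 1 := by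
    rwa [(extChartAt (𝓡 n) x₀).right_inv hzt]
  rw [hπ, differential_chartLift_mul hψ _ hzs hz', differential_chartLift_mul hψ _ hzs hz',
    component, coordCovector_eq hzs, coordCovector_eq hzs]

/-- Uniqueness holds because every complex covector at `x` is the differential of some function in
`C_c^∞(M)`, so a bivector at `x` is determined by its values on differentials. -/
theorem existsUnique_isPoissonField : ∃! π : ∀ x : M, BivectorAt n x, IsPoissonField D π := by
  refine ⟨poissonField D, ⟨isSmoothBivector_of_bracket D fun f g x =>
    (poissonField_apply D f g x).symm, fun f g x => (poissonField_apply D f g x).symm⟩, ?_⟩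
  rintro π ⟨-, hπ⟩
  funext x
  refine AlternatingMap.ext fun v => ?_
  have hv : v = ![differential (n := n) (primitiveAt x (v 0) : M → ℂ) x,
      differential (n := n) (primitiveAt x (v 1) : M → ℂ) x] := by
    rw [differential_primitiveAt, differential_primitiveAt]
    ext i
    fin_cases i <;> rfl
  rw [hv, ← hπ, poissonField_apply]

end PoissonField

/-! ### Linear algebra of top degree forms and contractions -/

section ContractionAlgebra

/-- The form `du ∧ vol` has degree greater than the dimension, hence vanishes. Expanding its value
on `(a, b, v)` and isolating the terms where `du` takes `a` or `b` gives the identity. -/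
theorem sum_removeNth_of_top_form {m : ℕ}
    (vol : EuclideanSpace ℝ (Fin (m + 2)) [⋀^Fin (m + 2)]→L[ℝ] ℝ)
    (du : EuclideanSpace ℝ (Fin (m + 2)) →L[ℝ] ℂ) (a b : EuclideanSpace ℝ (Fin (m + 2)))
    (v : Fin (m + 1) → EuclideanSpace ℝ (Fin (m + 2))) :
    ∑ i : Fin (m + 1), (-1 : ℂ) ^ (i : ℕ) *
      (du (v i) * (vol (Matrix.vecCons a (Matrix.vecCons b (i.removeNth v))) : ℂ)) =
    du b * (vol (Matrix.vecCons a v) : ℂ) - du a * (vol (Matrix.vecCons b v) : ℂ) := by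
  let f : EuclideanSpace ℝ (Fin (m + 2)) →L[ℝ]
      EuclideanSpace ℝ (Fin (m + 2)) [⋀^Fin (m + 2)]→L[ℝ] ℂ :=
    du.smulRight (Complex.ofRealCLM.compContinuousAlternatingMap vol)
  have hf : ∀ w x, f w x = du w * (vol x : ℂ) := fun w x => rfl
  have h0 : ContinuousAlternatingMap.alternatizeUncurryFin f
      (Matrix.vecCons a (Matrix.vecCons b v)) = 0 := by
    refine AlternatingMap.map_linearDependent
      (ContinuousAlternatingMap.alternatizeUncurryFin f).toAlternatingMap _ fun h => ?_
    have := h.fintype_card_le_finrank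
    simp at this
  rw [ContinuousAlternatingMap.alternatizeUncurryFin_apply, Fin.sum_univ_succ,
    Fin.sum_univ_succ] at h0
  have r0 : (0 : Fin (m + 3)).removeNth (Matrix.vecCons a (Matrix.vecCons b v)) =
      Matrix.vecCons b v := by
    ext1 j; simp [Fin.removeNth]
  have r1 : (Fin.succ 0 : Fin (m + 3)).removeNth (Matrix.vecCons a (Matrix.vecCons b v)) =
      Matrix.vecCons a v := by
    ext1 j
    refine Fin.cases ?_ (fun j => ?_) j
    · rfl
    · simp [Fin.removeNth]
  have r2 : ∀ i : Fin (m + 1), (i.succ.succ : Fin (m + 3)).removeNth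
      (Matrix.vecCons a (Matrix.vecCons b v)) =
      Matrix.vecCons a (Matrix.vecCons b (i.removeNth v)) := by
    intro i
    ext1 j
    refine Fin.cases rfl (fun j => ?_) j
    refine Fin.cases ?_ (fun j => ?_) j
    · rfl
    · simp [Fin.removeNth]
  simp only [hf, r0, r1, r2, Matrix.cons_val_zero, Matrix.cons_val_succ, Fin.val_zero,
    Fin.val_succ, pow_zero, one_smul, zero_add, pow_one] at h0
  have h1 : ∀ i : Fin (m + 1), (-1 : ℤ) ^ ((i : ℕ) + 1 + 1) • (du (v i) *
      (vol (Matrix.vecCons a (Matrix.vecCons b (i.removeNth v))) : ℂ)) = (-1 : ℂ) ^ (i : ℕ) *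
      (du (v i) * (vol (Matrix.vecCons a (Matrix.vecCons b (i.removeNth v))) : ℂ)) := by
    intro i
    rw [zsmul_eq_mul, pow_succ, pow_succ]
    push_cast
    ring
  rw [Finset.sum_congr rfl fun i _ => h1 i] at h0
  rw [zsmul_eq_mul] at h0
  push_cast at h0
  linear_combination h0

theorem exists_top_form (n : ℕ) :
    ∃ vol : EuclideanSpace ℝ (Fin n) [⋀^Fin n]→L[ℝ] ℝ,
      vol (fun i => EuclideanSpace.single i 1) = 1 := by
  let b := (EuclideanSpace.basisFun (Fin n) ℝ).toBasis
  have hc : Continuous fun v : Fin n → EuclideanSpace ℝ (Fin n) => b.det v := by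
    have : ∀ v, b.det v = (Matrix.of fun i j => v j i).det := fun v => by
      rw [Module.Basis.det_apply]; rfl
    simp_rw [this]
    refine Continuous.matrix_det (continuous_matrix fun i j => ?_)
    simp only [Matrix.of_apply]
    fun_prop
  refine ⟨⟨⟨b.det.toMultilinearMap, hc⟩, b.det.map_eq_zero_of_eq'⟩, ?_⟩
  change b.det (fun i => EuclideanSpace.single i 1) = 1
  have : (fun i => EuclideanSpace.single i 1) = b := by
    ext1 i; simp [b]
  rw [this, b.det_self]

/-- A form of top degree is determined by its value on the standard basis. -/
theorem top_form_eq_smul {n : ℕ} {vol : EuclideanSpace ℝ (Fin n) [⋀^Fin n]→L[ℝ] ℝ}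
    (hvol : vol (fun i => EuclideanSpace.single i 1) = 1)
    (α : EuclideanSpace ℝ (Fin n) [⋀^Fin n]→L[ℝ] ℝ) :
    α = α (fun i => EuclideanSpace.single i 1) • vol := by
  let b := (EuclideanSpace.basisFun (Fin n) ℝ).toBasis
  have hb : (b : Fin n → EuclideanSpace ℝ (Fin n)) = fun i => EuclideanSpace.single i 1 := by
    ext1 i; simp [b]
  have h1 := α.toAlternatingMap.eq_smul_basis_det b
  have h2 := vol.toAlternatingMap.eq_smul_basis_det b
  rw [hb] at h1 h2
  ext v
  have h1v : α v = α (fun i => EuclideanSpace.single i 1) * b.det v := DFunLike.congr_fun h1 v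
  have h2v : vol v = vol (fun i => EuclideanSpace.single i 1) * b.det v := DFunLike.congr_fun h2 v
  rw [hvol, one_mul] at h2v
  rw [h1v, ContinuousAlternatingMap.smul_apply, h2v, smul_eq_mul]

/-- The value of a form of top degree on the images of the standard basis vectors. -/
theorem top_form_comp {n : ℕ} (α : EuclideanSpace ℝ (Fin n) [⋀^Fin n]→L[ℝ] ℝ)
    (L : EuclideanSpace ℝ (Fin n) →L[ℝ] EuclideanSpace ℝ (Fin n)) :
    α (fun i => L (EuclideanSpace.single i 1)) =
      L.det * α (fun i => EuclideanSpace.single i 1) := by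
  let b := (EuclideanSpace.basisFun (Fin n) ℝ).toBasis
  have hb : (b : Fin n → EuclideanSpace ℝ (Fin n)) = fun i => EuclideanSpace.single i 1 := by
    ext1 i; simp [b]
  have h1 := α.toAlternatingMap.eq_smul_basis_det b
  have h1v : ∀ v, α v = α b * b.det v := fun v => DFunLike.congr_fun h1 v
  have h3 := b.det_comp (L : EuclideanSpace ℝ (Fin n) →ₗ[ℝ] EuclideanSpace ℝ (Fin n)) b
  rw [← hb, h1v]
  rw [b.det_self, mul_one] at h3
  have h4 : b.det (fun i => L (EuclideanSpace.single i 1)) = L.det := by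
    rw [hb] at h3
    exact h3
  rw [h4, mul_comm]

section Bilinear

variable {V : Type*} [AddCommGroup V] [Module ℂ V] (π : V [⋀^Fin 2]→ₗ[ℂ] ℂ)

theorem bivector_swap (a b : V) : π ![a, b] = - π ![b, a] := by
  rw [← π.map_swap _ (show (0 : Fin 2) ≠ 1 by decide)]
  congr 1
  ext i
  fin_cases i <;> simp

/-- A bivector as a bilinear form. -/
def bivectorBilin : V →ₗ[ℂ] V →ₗ[ℂ] ℂ :=
  LinearMap.mk₂ ℂ (fun a b => π ![a, b])
    (fun a a' b => π.map_vecCons_add ![b] a a')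
    (fun c a b => π.map_vecCons_smul ![b] c a)
    (fun a b b' => by
      rw [bivector_swap, π.map_vecCons_add ![a], neg_add, ← bivector_swap, ← bivector_swap])
    (fun c a b => by
      rw [bivector_swap, π.map_vecCons_smul ![a], ← smul_neg, ← bivector_swap])

theorem bivectorBilin_apply (a b : V) : bivectorBilin π a b = π ![a, b] := rfl

end Bilinear

theorem covector_eq_sum {n : ℕ} (α : EuclideanSpace ℝ (Fin n) →L[ℝ] ℂ) :
    α = ∑ c, α (EuclideanSpace.single c 1) •
      (Complex.ofRealCLM ∘L EuclideanSpace.proj c : EuclideanSpace ℝ (Fin n) →L[ℝ] ℂ) := by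
  ext v
  conv_lhs => rw [euclidean_eq_sum v, map_sum]
  simp [mul_comm]

/-- Contraction may be computed in any basis `L e₁, …, L e_d`; the dual basis is given by the
components of `L'`. -/
theorem contractLinear_apply {d k : ℕ} (π : (EuclideanSpace ℝ (Fin d) →L[ℝ] ℂ) [⋀^Fin 2]→ₗ[ℂ] ℂ)
    (α : EuclideanSpace ℝ (Fin d) [⋀^Fin (k + 2)]→L[ℝ] ℝ)
    {L L' : EuclideanSpace ℝ (Fin d) →L[ℝ] EuclideanSpace ℝ (Fin d)}
    (hL : L ∘L L' = ContinuousLinearMap.id ℝ _) (v : Fin k → EuclideanSpace ℝ (Fin d)) :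
    contractLinear π α v = ∑ a, ∑ b, (1 / 2 : ℂ) *
      π ![(Complex.ofRealCLM ∘L EuclideanSpace.proj a) ∘L L',
        (Complex.ofRealCLM ∘L EuclideanSpace.proj b) ∘L L'] *
      (α (Matrix.vecCons (L (EuclideanSpace.single a 1))
        (Matrix.vecCons (L (EuclideanSpace.single b 1)) v)) : ℂ) := by
  let e : Fin d → EuclideanSpace ℝ (Fin d) := fun a => EuclideanSpace.single a 1
  let p : Fin d → (EuclideanSpace ℝ (Fin d) →L[ℝ] ℂ) :=
    fun a => Complex.ofRealCLM ∘L EuclideanSpace.proj a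
  -- Covectors are expanded in the dual basis `p c ∘L L'` and the vectors `L (e c)` in the standard
  -- basis. Both carry the same matrix entries `L (e c) a`, so the two sides become the same
  -- fourfold sum.
  have hp : ∀ a, p a = ∑ c, ((L (e c) a : ℝ) : ℂ) • (p c ∘L L') := by
    intro a
    have h1 : p a = (p a ∘L L) ∘L L' := by
      rw [ContinuousLinearMap.comp_assoc, hL]; rfl
    conv_lhs => rw [h1, covector_eq_sum (p a ∘L L)]
    ext w
    simp [p, e]
  have hLe : ∀ c, L (e c) = ∑ a, (L (e c) a) • e a := fun c => euclidean_eq_sum _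
  let β : EuclideanSpace ℝ (Fin d) →ₗ[ℝ] EuclideanSpace ℝ (Fin d) →ₗ[ℝ] ℝ :=
    LinearMap.mk₂ ℝ (fun u w => α (Matrix.vecCons u (Matrix.vecCons w v)))
      (fun u u' w => α.map_vecCons_add _ u u') (fun c u w => α.map_vecCons_smul _ c u)
      (fun u w w' => (α.curryLeft u).map_vecCons_add v w w')
      (fun c u w => (α.curryLeft u).map_vecCons_smul v c w)
  have hlhs : contractLinear π α v = ∑ a, ∑ b, (1 / 2 : ℂ) * π ![p a, p b] *
      ((β (e a) (e b) : ℝ) : ℂ) := by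
    change (∑ a, ∑ b, ((1 / 2 : ℂ) * π ![p a, p b]) •
      Complex.ofRealCLM.compContinuousAlternatingMap ((α.curryLeft (e a)).curryLeft (e b)) :
      EuclideanSpace ℝ (Fin d) [⋀^Fin k]→L[ℝ] ℂ) v = _
    simp only [ContinuousAlternatingMap.sum_apply]
    rfl
  rw [hlhs]
  change _ = ∑ c, ∑ d, (1 / 2 : ℂ) * π ![p c ∘L L', p d ∘L L'] *
    ((β (L (e c)) (L (e d)) : ℝ) : ℂ)
  have hπ : ∀ a b, π ![p a, p b] = ∑ c, ∑ d, ((L (e c) a : ℝ) : ℂ) * (((L (e d) b : ℝ) : ℂ) *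
      π ![p c ∘L L', p d ∘L L']) := by
    intro a b
    rw [← bivectorBilin_apply]
    conv_lhs => rw [hp a, hp b]
    simp only [map_sum, LinearMap.sum_apply, map_smul, LinearMap.smul_apply, smul_eq_mul,
      bivectorBilin_apply, Finset.mul_sum]
    rw [Finset.sum_comm]
    refine Finset.sum_congr rfl fun _ _ => Finset.sum_congr rfl fun _ _ => ?_
    ring
  have hβ : ∀ c d, ((β (L (e c)) (L (e d)) : ℝ) : ℂ) = ∑ a, ∑ b, ((L (e c) a : ℝ) : ℂ) *
      (((L (e d) b : ℝ) : ℂ) * ((β (e a) (e b) : ℝ) : ℂ)) := by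
    intro c d
    conv_lhs => rw [hLe c, hLe d]
    simp only [map_sum, LinearMap.sum_apply, map_smul, LinearMap.smul_apply, smul_eq_mul,
      Finset.mul_sum]
    push_cast
    rw [Finset.sum_comm]
    refine Finset.sum_congr rfl fun _ _ => Finset.sum_congr rfl fun _ _ => ?_
    ring
  simp only [hπ, hβ, Finset.mul_sum, Finset.sum_mul]
  have hswap : ∀ T : Fin d → Fin d → Fin d → Fin d → ℂ,
      ∑ a, ∑ b, ∑ x, ∑ y, T a b x y = ∑ x, ∑ y, ∑ a, ∑ b, T a b x y := by
    intro T
    calc _ = ∑ a, ∑ x, ∑ b, ∑ y, T a b x y :=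
          Finset.sum_congr rfl fun _ _ => Finset.sum_comm
      _ = ∑ x, ∑ a, ∑ b, ∑ y, T a b x y := Finset.sum_comm
      _ = ∑ x, ∑ a, ∑ y, ∑ b, T a b x y :=
          Finset.sum_congr rfl fun _ _ => Finset.sum_congr rfl fun _ _ => Finset.sum_comm
      _ = ∑ x, ∑ y, ∑ a, ∑ b, T a b x y := Finset.sum_congr rfl fun _ _ => Finset.sum_comm
  rw [hswap]
  refine Finset.sum_congr rfl fun _ _ => Finset.sum_congr rfl fun _ _ =>
    Finset.sum_congr rfl fun _ _ => Finset.sum_congr rfl fun _ _ => ?_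
  ring

end ContractionAlgebra

/-! ### Exterior derivative of a contraction on `ℝⁿ` -/

section DivergenceForm

/-- The exterior derivative of the contraction of a bivector field with a top degree form on
`ℝⁿ` vanishes if and only if the divergence of the coefficients does. -/
theorem extDeriv_contraction_eq_zero_iff {m : ℕ}
    {vol : EuclideanSpace ℝ (Fin (m + 2)) [⋀^Fin (m + 2)]→L[ℝ] ℝ}
    (hvol : vol (fun i => EuclideanSpace.single i 1) = 1)
    {u : Fin (m + 2) → Fin (m + 2) → EuclideanSpace ℝ (Fin (m + 2)) → ℂ}
    {y : EuclideanSpace ℝ (Fin (m + 2))} (hu : ∀ a b, DifferentiableAt ℝ (u a b) y)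
    (hanti : ∀ a b, u a b =ᶠ[𝓝 y] fun z => - u b a z)
    {η : EuclideanSpace ℝ (Fin (m + 2)) → EuclideanSpace ℝ (Fin (m + 2)) [⋀^Fin m]→L[ℝ] ℂ}
    (hηd : DifferentiableAt ℝ η y)
    (hη : ∀ v, ∀ᶠ z in 𝓝 y, η z v = ∑ a, ∑ b, (1 / 2 : ℂ) * u a b z *
      (vol (Matrix.vecCons (EuclideanSpace.single a 1)
        (Matrix.vecCons (EuclideanSpace.single b 1) v)) : ℂ)) :
    extDeriv η y = 0 ↔ ∀ a, ∑ b, fderiv ℝ (u a b) y (EuclideanSpace.single b 1) = 0 := by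
  let e : Fin (m + 2) → EuclideanSpace ℝ (Fin (m + 2)) := fun a => EuclideanSpace.single a 1
  have hd : ∀ a b w, fderiv ℝ (u a b) y w = - fderiv ℝ (u b a) y w := by
    intro a b w
    rw [(hanti a b).fderiv_eq, fderiv_fun_neg]; rfl
  -- That is, `dη = ∑ₐ (∑_b ∂_b u^{ab}) e_a ⌟ vol`, the contraction of `vol` by the divergence
  -- vector.
  have key : ∀ v, extDeriv η y v = ∑ a, (∑ b, fderiv ℝ (u a b) y (e b)) *
      (vol (Matrix.vecCons (e a) v) : ℂ) := by
    intro v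
    rw [extDeriv_apply hηd]
    have h1 : ∀ i : Fin (m + 1), fderiv ℝ (η · (i.removeNth v)) y (v i) =
        ∑ a, ∑ b, (1 / 2 : ℂ) * (fderiv ℝ (u a b) y (v i) *
          (vol (Matrix.vecCons (e a) (Matrix.vecCons (e b) (i.removeNth v))) : ℂ)) := by
      intro i
      have hs : HasFDerivAt (fun z => ∑ a, ∑ b, (1 / 2 : ℂ) * u a b z *
          (vol (Matrix.vecCons (e a) (Matrix.vecCons (e b) (i.removeNth v))) : ℂ))
          (∑ a, ∑ b, (vol (Matrix.vecCons (e a) (Matrix.vecCons (e b) (i.removeNth v))) : ℂ) •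
            (1 / 2 : ℂ) • fderiv ℝ (u a b) y) y :=
        HasFDerivAt.fun_sum fun a _ => HasFDerivAt.fun_sum fun b _ =>
          ((hu a b).hasFDerivAt.const_mul _).mul_const _
      rw [Filter.EventuallyEq.fderiv_eq (hη (i.removeNth v)), hs.fderiv]
      simp only [sum_apply]
      refine Finset.sum_congr rfl fun _ _ => Finset.sum_congr rfl fun _ _ => ?_
      simp only [smul_apply, smul_eq_mul]
      ring
    have h2 : ∀ i : Fin (m + 1), (-1 : ℤ) ^ (i : ℕ) • fderiv ℝ (η · (i.removeNth v)) y (v i) =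
        ∑ a, ∑ b, (1 / 2 : ℂ) * ((-1 : ℂ) ^ (i : ℕ) * (fderiv ℝ (u a b) y (v i) *
          (vol (Matrix.vecCons (e a) (Matrix.vecCons (e b) (i.removeNth v))) : ℂ))) := by
      intro i
      rw [h1, zsmul_eq_mul, Finset.mul_sum]
      push_cast
      simp only [Finset.mul_sum]
      refine Finset.sum_congr rfl fun _ _ => Finset.sum_congr rfl fun _ _ => ?_
      ring
    rw [Finset.sum_congr rfl fun i _ => h2 i, Finset.sum_comm]
    have h3 : ∀ a, ∑ i : Fin (m + 1), ∑ b, (1 / 2 : ℂ) * ((-1 : ℂ) ^ (i : ℕ) *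
          (fderiv ℝ (u a b) y (v i) *
          (vol (Matrix.vecCons (e a) (Matrix.vecCons (e b) (i.removeNth v))) : ℂ))) =
        ∑ b, ((1 / 2 : ℂ) * (fderiv ℝ (u a b) y (e b) * (vol (Matrix.vecCons (e a) v) : ℂ)) +
          (1 / 2 : ℂ) * (fderiv ℝ (u b a) y (e a) * (vol (Matrix.vecCons (e b) v) : ℂ))) := by
      intro a
      rw [Finset.sum_comm]
      refine Finset.sum_congr rfl fun b _ => ?_
      -- Antisymmetry of `u` turns the difference into a sum of two terms exchanged by swapping `a`
      -- and `b`. Summed over both indices they are equal, which absorbs the factor `1/2`.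
      rw [← Finset.mul_sum, sum_removeNth_of_top_form, hd b a]
      ring
    rw [Finset.sum_congr rfl fun a _ => h3 a]
    simp only [Finset.sum_add_distrib]
    rw [Finset.sum_comm (f := fun a b => (1 / 2 : ℂ) * (fderiv ℝ (u b a) y (e a) *
      (vol (Matrix.vecCons (e b) v) : ℂ)))]
    rw [← Finset.sum_add_distrib]
    refine Finset.sum_congr rfl fun a _ => ?_
    rw [Finset.sum_mul, ← Finset.sum_add_distrib]
    refine Finset.sum_congr rfl fun b _ => ?_
    ring
  constructor
  · intro h a
    -- On the basis vectors other than `e a` only the term of index `a` survives, since the others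
    -- repeat a vector. Its factor is the sign of a permutation, hence nonzero.
    have h1 := key (fun j => e (a.succAbove j))
    rw [h, Finset.sum_eq_single a] at h1
    · have h2 : (vol (Matrix.vecCons (e a) fun j => e (a.succAbove j)) : ℂ) ≠ 0 := by
        have hcomp : (Matrix.vecCons (e a) fun j => e (a.succAbove j)) =
            e ∘ (Fin.cons a (a.succAbove) : Fin (m + 2) → Fin (m + 2)) := by
          ext1 j
          refine Fin.cases rfl (fun j => rfl) j
        have hinj : Function.Injective (Fin.cons a (a.succAbove) : Fin (m + 2) → Fin (m + 2)) := by
          rw [Fin.cons_injective_iff]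
          exact ⟨by simp, Fin.succAbove_right_injective⟩
        let σ : Equiv.Perm (Fin (m + 2)) :=
          Equiv.ofBijective _ (Finite.injective_iff_bijective.1 hinj)
        have h3 := vol.toAlternatingMap.map_perm e σ
        have h4 : vol (e ∘ σ) = Equiv.Perm.sign σ • vol e := h3
        rw [hcomp]
        change ((vol (e ∘ σ) : ℝ) : ℂ) ≠ 0
        rw [h4, hvol]
        rcases Int.units_eq_one_or (Equiv.Perm.sign σ) with h | h <;> simp [h]
      exact (mul_eq_zero.1 h1.symm).resolve_right h2
    · intro b _ hba
      obtain ⟨j, hj⟩ := Fin.exists_succAbove_eq hba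
      have : vol (Matrix.vecCons (e b) fun j => e (a.succAbove j)) = 0 := by
        refine vol.map_eq_zero_of_eq _ (i := 0) (j := j.succ) ?_ (Fin.succ_ne_zero _).symm
        simp [hj]
      rw [this]; simp
    · simp
  · intro h
    ext v
    rw [key v]
    exact Finset.sum_eq_zero fun a _ => by rw [show ∑ b, _ = (0 : ℂ) from h a, zero_mul]

end DivergenceForm

/-! ### The weighted divergence in a chart -/

section ChartDivergence

variable {n : ℕ} {M : Type*} [TopologicalSpace M] [ChartedSpace (EuclideanSpace ℝ (Fin n)) M]

/-- The product `ρ π^{ij}` of the density of `ε` and a component of `π` in a chart. -/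
def densityComponent (π : ∀ x : M, BivectorAt n x)
    (ε : ∀ x : M, TangentSpace (𝓡 n) x [⋀^Fin n]→L[ℝ] ℝ) (x₀ : M) (i j : Fin n)
    (y : EuclideanSpace ℝ (Fin n)) : ℂ :=
  (chartDensity ε x₀ y : ℂ) * component π x₀ i j ((extChartAt (𝓡 n) x₀).symm y)

/-- The divergence `∑ⱼ ∂ⱼ(ρ π^{ij})` in a chart. -/
def chartDivergence (π : ∀ x : M, BivectorAt n x)
    (ε : ∀ x : M, TangentSpace (𝓡 n) x [⋀^Fin n]→L[ℝ] ℝ) (x₀ : M) (i : Fin n)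
    (y : EuclideanSpace ℝ (Fin n)) : ℂ :=
  ∑ j, fderiv ℝ (densityComponent π ε x₀ i j) y (EuclideanSpace.single j 1)

theorem component_swap (π : ∀ x : M, BivectorAt n x) (x₀ : M) (i j : Fin n) (x : M) :
    component π x₀ i j x = - component π x₀ j i x :=
  bivector_swap _ _ _

theorem contDiffOn_chartDensity {ε : ∀ x : M, TangentSpace (𝓡 n) x [⋀^Fin n]→L[ℝ] ℝ}
    (hε : IsSmoothForm ε) (x₀ : M) :
    ContDiffOn ℝ ∞ (chartDensity ε x₀) (extChartAt (𝓡 n) x₀).target := by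
  have h := (ContinuousAlternatingMap.apply ℝ (EuclideanSpace ℝ (Fin n)) ℝ
    (fun i : Fin n => EuclideanSpace.single i (1 : ℝ))).contDiff (n := ∞)
  exact h.comp_contDiffOn (hε x₀)

theorem contDiffOn_densityComponent {ε : ∀ x : M, TangentSpace (𝓡 n) x [⋀^Fin n]→L[ℝ] ℝ}
    (hε : IsSmoothForm ε) {π : ∀ x : M, BivectorAt n x} (hπ : IsSmoothBivector π) (x₀ : M)
    (i j : Fin n) :
    ContDiffOn ℝ ∞ (densityComponent π ε x₀ i j) (extChartAt (𝓡 n) x₀).target :=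
  (Complex.ofRealCLM.contDiff.comp_contDiffOn (contDiffOn_chartDensity hε x₀)).mul (hπ x₀ i j)

variable [IsManifold (𝓡 n) ∞ M]

theorem chartDensity_ne_zero {ε : ∀ x : M, TangentSpace (𝓡 n) x [⋀^Fin n]→L[ℝ] ℝ}
    (hε : IsVolumeForm ε) {x₀ : M} {y : EuclideanSpace ℝ (Fin n)}
    (hy : y ∈ (extChartAt (𝓡 n) x₀).target) : chartDensity ε x₀ y ≠ 0 := by
  intro h0
  obtain ⟨vol, hvol⟩ := exists_top_form n
  have h1 : chartForm ε x₀ y = 0 := by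
    rw [top_form_eq_smul hvol (chartForm ε x₀ y)]
    exact (congrArg (· • vol) h0).trans (zero_smul _ _)
  refine hε.2 ((extChartAt (𝓡 n) x₀).symm y) ?_
  ext v
  have h2 := DFunLike.congr_fun h1 (fun i => mfderiv (𝓡 n) 𝓘(ℝ, EuclideanSpace ℝ (Fin n))
    (extChartAt (𝓡 n) x₀) ((extChartAt (𝓡 n) x₀).symm y) (v i))
  refine Eq.trans ?_ h2
  refine congrArg (ε ((extChartAt (𝓡 n) x₀).symm y)) (funext fun i => ?_)
  have h3 := mfderiv_chart_symm_comp ((extChartAt (𝓡 n) x₀).map_target hy)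
  rw [(extChartAt (𝓡 n) x₀).right_inv hy] at h3
  exact (DFunLike.congr_fun h3 (v i)).symm

end ChartDivergence

/-! ### Closedness of `π ⌟ ε` in charts -/

section ContractChart

/-- The contraction is defined with a basis that varies with the point. Basis independence
(`contractLinear_apply`), with `L` and `L'` the derivatives of the inverse chart and of the chart,
rewrites it in the coordinates of one fixed chart, where `ε` is `ρ` times `vol`. -/
theorem chartForm_contract_apply {m : ℕ} {M : Type*} [TopologicalSpace M]
    [ChartedSpace (EuclideanSpace ℝ (Fin (m + 2))) M] [IsManifold (𝓡 (m + 2)) ∞ M]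
    (π : ∀ x : M, BivectorAt (m + 2) x)
    (ε : ∀ x : M, TangentSpace (𝓡 (m + 2)) x [⋀^Fin (m + 2)]→L[ℝ] ℝ)
    {vol : EuclideanSpace ℝ (Fin (m + 2)) [⋀^Fin (m + 2)]→L[ℝ] ℝ}
    (hvol : vol (fun i => EuclideanSpace.single i 1) = 1) {x₀ : M}
    {y : EuclideanSpace ℝ (Fin (m + 2))} (hy : y ∈ (extChartAt (𝓡 (m + 2)) x₀).target)
    (v : Fin m → EuclideanSpace ℝ (Fin (m + 2))) :
    (chartForm (contract π ε) x₀ y : EuclideanSpace ℝ (Fin (m + 2)) [⋀^Fin m]→L[ℝ] ℂ) v =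
      ∑ a, ∑ b, (1 / 2 : ℂ) * densityComponent π ε x₀ a b y *
      (vol (Matrix.vecCons (EuclideanSpace.single a 1)
        (Matrix.vecCons (EuclideanSpace.single b 1) v)) : ℂ) := by
  set p := (extChartAt (𝓡 (m + 2)) x₀).symm y with hp
  let L : EuclideanSpace ℝ (Fin (m + 2)) →L[ℝ] EuclideanSpace ℝ (Fin (m + 2)) :=
    mfderiv 𝓘(ℝ, EuclideanSpace ℝ (Fin (m + 2))) (𝓡 (m + 2)) (extChartAt (𝓡 (m + 2)) x₀).symm y
  let L' : EuclideanSpace ℝ (Fin (m + 2)) →L[ℝ] EuclideanSpace ℝ (Fin (m + 2)) :=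
    mfderiv (𝓡 (m + 2)) 𝓘(ℝ, EuclideanSpace ℝ (Fin (m + 2))) (extChartAt (𝓡 (m + 2)) x₀) p
  have hps := (extChartAt (𝓡 (m + 2)) x₀).map_target hy
  have hLL : L ∘L L' = ContinuousLinearMap.id ℝ _ := by
    have h3 := mfderiv_chart_symm_comp hps
    rw [(extChartAt (𝓡 (m + 2)) x₀).right_inv hy] at h3
    exact h3
  have h1 := contractLinear_apply (k := m) (π p) (ε p) hLL (fun i => L (v i))
  refine Eq.trans h1 (Finset.sum_congr rfl fun a _ => Finset.sum_congr rfl fun b _ => ?_)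
  have h2 := DFunLike.congr_fun (top_form_eq_smul hvol (chartForm ε x₀ y))
    (Matrix.vecCons (EuclideanSpace.single a 1) (Matrix.vecCons (EuclideanSpace.single b 1) v))
  have h3 : (ε p) (Matrix.vecCons (L (EuclideanSpace.single a 1))
      (Matrix.vecCons (L (EuclideanSpace.single b 1)) fun i => L (v i))) =
      chartDensity ε x₀ y * vol (Matrix.vecCons (EuclideanSpace.single a 1)
        (Matrix.vecCons (EuclideanSpace.single b 1) v)) := by
    refine Eq.trans ?_ h2
    refine congrArg (ε p) (funext fun i => ?_)
    refine Fin.cases rfl (fun i => ?_) i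
    refine Fin.cases rfl (fun i => rfl) i
  have h4 : component π x₀ a b p = π p ![(Complex.ofRealCLM ∘L EuclideanSpace.proj a) ∘L L',
        (Complex.ofRealCLM ∘L EuclideanSpace.proj b) ∘L L'] := by
    rw [component, coordCovector_eq hps, coordCovector_eq hps]
  rw [densityComponent, ← hp, h4]
  refine (congrArg (fun t : ℝ => (1 / 2 : ℂ) *
    π p ![(Complex.ofRealCLM ∘L EuclideanSpace.proj a) ∘L L',
        (Complex.ofRealCLM ∘L EuclideanSpace.proj b) ∘L L'] * (t : ℂ)) h3).trans ?_
  push_cast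
  ring

theorem densityComponent_swap {n : ℕ} {M : Type*} [TopologicalSpace M]
    [ChartedSpace (EuclideanSpace ℝ (Fin n)) M] (π : ∀ x : M, BivectorAt n x)
    (ε : ∀ x : M, TangentSpace (𝓡 n) x [⋀^Fin n]→L[ℝ] ℝ) (x₀ : M) (i j : Fin n)
    (y : EuclideanSpace ℝ (Fin n)) :
    densityComponent π ε x₀ i j y = - densityComponent π ε x₀ j i y := by
  rw [densityComponent, component_swap, mul_neg, densityComponent]

theorem contract_eq_zero {n : ℕ} (hn : n < 2) {M : Type*} [TopologicalSpace M]
    [ChartedSpace (EuclideanSpace ℝ (Fin n)) M] (π : ∀ x : M, BivectorAt n x)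
    (ε : ∀ x : M, TangentSpace (𝓡 n) x [⋀^Fin n]→L[ℝ] ℝ) : contract π ε = 0 := by
  rcases n with _ | _ | m
  · rfl
  · rfl
  · omega

theorem extDeriv_zero {n k : ℕ} (y : EuclideanSpace ℝ (Fin n)) :
    extDeriv (0 : EuclideanSpace ℝ (Fin n) → EuclideanSpace ℝ (Fin n) [⋀^Fin k]→L[ℝ] ℂ) y = 0 := by
  ext v
  refine (extDeriv_apply (differentiableAt_const (0 : EuclideanSpace ℝ (Fin n) [⋀^Fin k]→L[ℝ] ℂ))
    v).trans ?_
  simp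

theorem chartForm_zero {n k : ℕ} {M : Type*} [TopologicalSpace M]
    [ChartedSpace (EuclideanSpace ℝ (Fin n)) M] (x₀ : M) :
    chartForm (0 : ∀ x : M, TangentSpace (𝓡 n) x [⋀^Fin k]→L[ℝ] ℂ) x₀ = 0 := rfl

variable {n : ℕ} {M : Type*} [TopologicalSpace M]
  [ChartedSpace (EuclideanSpace ℝ (Fin n)) M] [IsManifold (𝓡 n) ∞ M]
  {π : ∀ x : M, BivectorAt n x} {ε : ∀ x : M, TangentSpace (𝓡 n) x [⋀^Fin n]→L[ℝ] ℝ}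

theorem differentiableAt_chartForm_contract (hε : IsSmoothForm ε) (hπ : IsSmoothBivector π)
    {x₀ : M} {y : EuclideanSpace ℝ (Fin n)} (hy : y ∈ (extChartAt (𝓡 n) x₀).target) :
    DifferentiableAt ℝ (chartForm (contract π ε) x₀) y := by
  rcases n with _ | _ | m
  · rw [contract_eq_zero (by norm_num), chartForm_zero]
    exact differentiableAt_const _
  · rw [contract_eq_zero (by norm_num), chartForm_zero]
    exact differentiableAt_const _
  · obtain ⟨vol, hvol⟩ := exists_top_form (m + 2)
    let e : Fin (m + 2) → EuclideanSpace ℝ (Fin (m + 2)) := fun a => EuclideanSpace.single a 1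
    let Ω : Fin (m + 2) → Fin (m + 2) → EuclideanSpace ℝ (Fin (m + 2)) [⋀^Fin m]→L[ℝ] ℂ :=
      fun a b => Complex.ofRealCLM.compContinuousAlternatingMap
        ((vol.curryLeft (e a)).curryLeft (e b))
    have hnhds := (isOpen_chartTarget x₀).mem_nhds hy
    have h1 : (chartForm (contract π ε) x₀ : EuclideanSpace ℝ (Fin (m + 2)) →
        EuclideanSpace ℝ (Fin (m + 2)) [⋀^Fin m]→L[ℝ] ℂ) =ᶠ[𝓝 y]
        fun z => ∑ a, ∑ b, ((1 / 2 : ℂ) * densityComponent π ε x₀ a b z) • Ω a b := by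
      filter_upwards [hnhds] with z hz
      ext v
      refine (chartForm_contract_apply π ε hvol hz v).trans ?_
      simp only [ContinuousAlternatingMap.sum_apply]
      rfl
    refine DifferentiableAt.congr_of_eventuallyEq ?_ h1
    refine DifferentiableAt.fun_sum fun a _ => DifferentiableAt.fun_sum fun b _ => ?_
    exact ((((contDiffOn_densityComponent hε hπ x₀ a b).contDiffAt hnhds).differentiableAt
      (by simp)).const_mul _).smul_const _

/-- In a chart, closedness of `π ⌟ ε` is vanishing of the divergence of `ρ π`. -/
theorem extDeriv_chartForm_contract_eq_zero_iff (hε : IsSmoothForm ε) (hπ : IsSmoothBivector π)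
    {x₀ : M} {y : EuclideanSpace ℝ (Fin n)} (hy : y ∈ (extChartAt (𝓡 n) x₀).target) :
    extDeriv (chartForm (contract π ε) x₀) y = 0 ↔ ∀ i, chartDivergence π ε x₀ i y = 0 := by
  have hd := differentiableAt_chartForm_contract hε hπ hy
  have hnhds := (isOpen_chartTarget x₀).mem_nhds hy
  rcases n with _ | _ | m
  · refine iff_of_true ?_ fun i => i.elim0
    rw [contract_eq_zero (by norm_num), chartForm_zero, extDeriv_zero]
  · refine iff_of_true ?_ fun i => ?_
    · rw [contract_eq_zero (by norm_num), chartForm_zero, extDeriv_zero]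
    -- In dimension one the contraction is zero by convention, and the divergence vanishes too
    -- because the only component is antisymmetric.
    · have h0 : ∀ j, densityComponent π ε x₀ i j = 0 := by
        intro j
        funext z
        have := densityComponent_swap π ε x₀ i j z
        rw [show j = i from Fin.ext (by omega)] at this ⊢
        exact self_eq_neg.1 this
      simp [chartDivergence, h0]
  · obtain ⟨vol, hvol⟩ := exists_top_form (m + 2)
    exact extDeriv_contraction_eq_zero_iff hvol (u := densityComponent π ε x₀)
      (fun a b => ((contDiffOn_densityComponent hε hπ x₀ a b).contDiffAt hnhds).differentiableAt
        (by simp))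
      (fun a b => Eventually.of_forall (densityComponent_swap π ε x₀ a b)) hd
      (fun v => Filter.mem_of_superset hnhds
        fun z hz => chartForm_contract_apply π ε hvol hz v)

/-- The form `π ⌟ ε` is closed if and only if the divergence of `ρ π` vanishes in all charts. -/
theorem closed_contract_iff (hε : IsSmoothForm ε) (hπ : IsSmoothBivector π) :
    (∀ x, exteriorDerivative (contract π ε) x = 0) ↔
      ∀ x₀ : M, ∀ x ∈ (extChartAt (𝓡 n) x₀).source, ∀ i,
        chartDivergence π ε x₀ i (extChartAt (𝓡 n) x₀ x) = 0 := by
  have key : ∀ x₀ : M, ∀ x ∈ (extChartAt (𝓡 n) x₀).source,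
      (exteriorDerivative (contract π ε) x = 0 ↔ ∀ i,
        chartDivergence π ε x₀ i (extChartAt (𝓡 n) x₀ x) = 0) := fun x₀ x hx => by
    have hy := (extChartAt (𝓡 n) x₀).map_source hx
    rw [exteriorDerivative_eq_zero_iff _ hx (differentiableAt_chartForm_contract hε hπ hy),
      extDeriv_chartForm_contract_eq_zero_iff hε hπ hy]
  exact ⟨fun h x₀ x hx => (key x₀ x hx).1 (h x),
    fun h x => (key x x (mem_extChartAt_source x)).2 (h x x (mem_extChartAt_source x))⟩

end ContractChart

/-! ### Torsion-free connections preserving the volume form -/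

section ConnectionCoordinates

variable {n : ℕ} {M : Type*} [TopologicalSpace M] [ChartedSpace (EuclideanSpace ℝ (Fin n)) M]
  [IsManifold (𝓡 n) ∞ M]

theorem chartForm_apply_mfderiv {F : Type*} [NormedAddCommGroup F] [NormedSpace ℝ F] {k : ℕ}
    (α : ∀ x : M, TangentSpace (𝓡 n) x [⋀^Fin k]→L[ℝ] F) {x₀ q : M}
    (hq : q ∈ (extChartAt (𝓡 n) x₀).source) (v : Fin k → TangentSpace (𝓡 n) q) :
    chartForm α x₀ (extChartAt (𝓡 n) x₀ q) (fun i => mfderiv (𝓡 n)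
      𝓘(ℝ, EuclideanSpace ℝ (Fin n)) (extChartAt (𝓡 n) x₀) q (v i)) = α q v := by
  have h1 := mfderiv_chart_symm_comp hq
  have h2 : ∀ (p : M), p = q → (α p) (fun i =>
      ((mfderiv 𝓘(ℝ, EuclideanSpace ℝ (Fin n)) (𝓡 n) (extChartAt (𝓡 n) x₀).symm
        (extChartAt (𝓡 n) x₀ q)) ∘L (mfderiv (𝓡 n)
      𝓘(ℝ, EuclideanSpace ℝ (Fin n)) (extChartAt (𝓡 n) x₀) q)) (v i)) = α q v := by
    rintro p rfl
    congr 1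
    ext1 i
    exact DFunLike.congr_fun h1 _
  exact h2 _ ((extChartAt (𝓡 n) x₀).left_inv hq)

theorem mfderiv_chart_coordField {x₀ x : M} (hx : x ∈ (extChartAt (𝓡 n) x₀).source) (l : Fin n) :
    mfderiv (𝓡 n) 𝓘(ℝ, EuclideanSpace ℝ (Fin n)) (extChartAt (𝓡 n) x₀) x (coordField x₀ l x) =
      (EuclideanSpace.single l (1 : ℝ) : EuclideanSpace ℝ (Fin n)) :=
  (isInvertible_mfderiv_extChartAt hx).self_apply_inverse _

theorem mfderiv_chart_injective {x₀ x : M} (hx : x ∈ (extChartAt (𝓡 n) x₀).source) :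
    Function.Injective
      (mfderiv (𝓡 n) 𝓘(ℝ, EuclideanSpace ℝ (Fin n)) (extChartAt (𝓡 n) x₀) x) :=
  (isInvertible_mfderiv_extChartAt hx).injective

theorem form_coordField (ε : ∀ x : M, TangentSpace (𝓡 n) x [⋀^Fin n]→L[ℝ] ℝ) {x₀ x : M}
    (hx : x ∈ (extChartAt (𝓡 n) x₀).source) :
    ε x (fun i => coordField x₀ i x) = chartDensity ε x₀ (extChartAt (𝓡 n) x₀ x) := by
  rw [← chartForm_apply_mfderiv ε hx, chartDensity]
  exact congrArg _ (funext fun i => mfderiv_chart_coordField hx i)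

theorem contMDiffAt_coordField {x₀ x : M} (hx : x ∈ (extChartAt (𝓡 n) x₀).source) (l : Fin n) :
    ContMDiffAt (𝓡 n) (𝓡 n).tangent ∞
      (fun x => (⟨x, coordField x₀ l x⟩ : TangentBundle (𝓡 n) M)) x := by
  refine ContMDiffAt.mpullback_vectorField_preimage (n := ∞) (m := ∞)
    (V := fun _ => (EuclideanSpace.single l (1 : ℝ) : EuclideanSpace ℝ (Fin n)))
    ?_ (contMDiffAt_chart hx) (isInvertible_mfderiv_extChartAt hx) le_rfl
  exact contMDiffAt_vectorSpace_iff_contDiffAt.2 contDiffAt_const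

theorem mdifferentiableAt_coordField {x₀ x : M} (hx : x ∈ (extChartAt (𝓡 n) x₀).source)
    (l : Fin n) : MDifferentiableAt (𝓡 n) (𝓡 n).tangent
      (fun x => (⟨x, coordField x₀ l x⟩ : TangentBundle (𝓡 n) M)) x :=
  (contMDiffAt_coordField hx l).mdifferentiableAt (by simp)

/-- Coordinate fields are pullbacks of constant fields, and pullback commutes with the Lie bracket.
This turns vanishing torsion into symmetry of the Christoffel symbols. -/
theorem mlieBracket_coordField {x₀ x : M} (hx : x ∈ (extChartAt (𝓡 n) x₀).source) (k l : Fin n) :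
    VectorField.mlieBracket (𝓡 n) (coordField x₀ k) (coordField x₀ l) x = 0 := by
  let V : Fin n → ∀ y : EuclideanSpace ℝ (Fin n),
      TangentSpace 𝓘(ℝ, EuclideanSpace ℝ (Fin n)) y :=
    fun l _ => (EuclideanSpace.single l (1 : ℝ) : EuclideanSpace ℝ (Fin n))
  have hV : ∀ l, MDifferentiableAt 𝓘(ℝ, EuclideanSpace ℝ (Fin n))
      (𝓘(ℝ, EuclideanSpace ℝ (Fin n))).tangent
      (fun y => (⟨y, V l y⟩ : TangentBundle 𝓘(ℝ, EuclideanSpace ℝ (Fin n)) _))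
      (extChartAt (𝓡 n) x₀ x) := fun l =>
    (contMDiffAt_vectorSpace_iff_contDiffAt (n := ∞).2 contDiffAt_const).mdifferentiableAt (by simp)
  have : IsManifold (𝓡 n) (minSmoothness ℝ 2) M := by
    rw [minSmoothness_of_isRCLikeNormedField]; infer_instance
  have h := VectorField.mpullback_mlieBracket (n := ∞) (hV k) (hV l) (contMDiffAt_chart hx)
    (by rw [minSmoothness_of_isRCLikeNormedField]; norm_cast)
  have h0 : VectorField.mlieBracket 𝓘(ℝ, EuclideanSpace ℝ (Fin n)) (V k) (V l) = 0 := by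
    rw [← VectorField.mlieBracketWithin_univ, VectorField.mlieBracketWithin_eq_lieBracketWithin]
    funext y
    simp [VectorField.lieBracketWithin, V]
    rfl
  refine h.symm.trans ?_
  rw [h0]
  exact map_zero (mfderiv (𝓡 n) 𝓘(ℝ, EuclideanSpace ℝ (Fin n)) (extChartAt (𝓡 n) x₀) x).inverse

/-- The Christoffel symbols as real numbers. -/
def realChristoffel (cov : AffineConnection n M) (x₀ : M) (i k l : Fin n) (x : M) : ℝ :=
  (EuclideanSpace.proj i : EuclideanSpace ℝ (Fin n) →L[ℝ] ℝ)
    (mfderiv (𝓡 n) 𝓘(ℝ, EuclideanSpace ℝ (Fin n)) (extChartAt (𝓡 n) x₀) x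
      (cov (coordField x₀ l) x (coordField x₀ k x)))

theorem christoffel_eq (cov : AffineConnection n M) {x₀ x : M}
    (hx : x ∈ (extChartAt (𝓡 n) x₀).source) (i k l : Fin n) :
    christoffel cov x₀ i k l x = realChristoffel cov x₀ i k l x := by
  rw [christoffel, coordCovector_eq hx]
  rfl

theorem christoffel_symm {cov : AffineConnection n M} (hcov : cov.torsion = 0) {x₀ x : M}
    (hx : x ∈ (extChartAt (𝓡 n) x₀).source) (i k l : Fin n) :
    christoffel cov x₀ i k l x = christoffel cov x₀ i l k x := by
  have h := cov.torsion_eq_zero_iff.1 hcov (mdifferentiableAt_coordField hx k)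
    (mdifferentiableAt_coordField hx l)
  rw [mlieBracket_coordField hx, sub_eq_zero] at h
  rw [christoffel, christoffel, h]

theorem covariantDerivative_coordField (cov : AffineConnection n M) {x₀ x : M}
    (hx : x ∈ (extChartAt (𝓡 n) x₀).source) (k l : Fin n) :
    cov (coordField x₀ l) x (coordField x₀ k x) =
      ∑ i, realChristoffel cov x₀ i k l x • coordField x₀ i x := by
  apply mfderiv_chart_injective hx
  rw [map_sum]
  simp_rw [map_smul, mfderiv_chart_coordField hx]
  exact euclidean_eq_sum _

variable [T2Space M]

/-- `IsParallel` only tests globally smooth fields, so the coordinate fields are multiplied by a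
bump function supported in the chart domain. -/
theorem exists_contMDiff_eventuallyEq_coordField {x₀ x : M}
    (hx : x ∈ (extChartAt (𝓡 n) x₀).source) :
    ∃ Y : Fin n → ∀ x : M, TangentSpace (𝓡 n) x,
      (∀ i, ContMDiff (𝓡 n) (𝓡 n).tangent ∞
        (fun x => (⟨x, Y i x⟩ : TangentBundle (𝓡 n) M))) ∧
      ∀ᶠ q in 𝓝 x, ∀ i, Y i q = coordField x₀ i q := by
  have hs := (isOpen_extChartAt_source (I := 𝓡 n) x₀)
  obtain ⟨f, -, hf⟩ := (SmoothBumpFunction.nhds_basis_tsupport (I := 𝓡 n) x).mem_iff.1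
    (hs.mem_nhds hx)
  refine ⟨fun i => (f : M → ℝ) • coordField x₀ i, fun i => ?_, ?_⟩
  · exact ContMDiffOn.smul_section_of_tsupport (f.contMDiff.contMDiffOn) hs hf
      fun q hq => (contMDiffAt_coordField hq i).contMDiffWithinAt
  · filter_upwards [f.eventuallyEq_one] with q hq i
    simp [hq]

/-- Apply `∇ε = 0` to `ρ = ε(∂₁, …, ∂ₙ)`. In the slot of `∂ᵢ`, every component of `∇_k ∂ᵢ` other
than the one along `∂ᵢ` repeats a vector, so only the trace `∑ᵢ Γ^i_{ki}` remains. -/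
theorem fderiv_chartDensity {cov : AffineConnection n M}
    {ε : ∀ x : M, TangentSpace (𝓡 n) x [⋀^Fin n]→L[ℝ] ℝ} (hε : IsSmoothForm ε)
    (hpar : IsParallel cov ε) {x₀ x : M}
    (hx : x ∈ (extChartAt (𝓡 n) x₀).source) (k : Fin n) :
    fderiv ℝ (chartDensity ε x₀) (extChartAt (𝓡 n) x₀ x) (EuclideanSpace.single k 1) =
      (∑ i, realChristoffel cov x₀ i k i x) * chartDensity ε x₀ (extChartAt (𝓡 n) x₀ x) := by
  obtain ⟨Y, hY, hYe⟩ := exists_contMDiff_eventuallyEq_coordField hx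
  have h := hpar Y hY x (coordField x₀ k x)
  have hYx := hYe.self_of_nhds
  have hl : (fun p => ε p (fun i => Y i p)) =ᶠ[𝓝 x] chartDensity ε x₀ ∘ extChartAt (𝓡 n) x₀ := by
    filter_upwards [hYe, (isOpen_extChartAt_source (I := 𝓡 n) x₀).mem_nhds hx] with q hq hqs
    rw [Function.comp_apply, ← form_coordField ε hqs]
    exact congrArg _ (funext hq)
  have hd : DifferentiableAt ℝ (chartDensity ε x₀) (extChartAt (𝓡 n) x₀ x) :=
    ((contDiffOn_chartDensity hε x₀).contDiffAt ((isOpen_chartTarget x₀).mem_nhds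
      ((extChartAt (𝓡 n) x₀).map_source hx))).differentiableAt (by simp)
  have hL : (mfderiv (𝓡 n) 𝓘(ℝ, ℝ) (fun p => ε p (fun i => Y i p)) x (coordField x₀ k x) : ℝ) =
      fderiv ℝ (chartDensity ε x₀) (extChartAt (𝓡 n) x₀ x) (EuclideanSpace.single k 1) := by
    rw [hl.mfderiv_eq, mfderiv_comp x hd.mdifferentiableAt (mdifferentiableAt_chart hx),
      mfderiv_eq_fderiv]
    exact congrArg (fderiv ℝ (chartDensity ε x₀) (extChartAt (𝓡 n) x₀ x))
      (mfderiv_chart_coordField hx k)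
  rw [← hL, h, Finset.sum_mul]
  refine Finset.sum_congr rfl fun i _ => ?_
  -- A connection is local: it does not distinguish fields that agree near `x`.
  have hc : cov (Y i) x = cov (coordField x₀ i) x :=
    cov.isCovariantDerivativeOn.congr_of_eventuallyEq (s := univ)
      ((hY i).mdifferentiableAt (by simp)) (mdifferentiableAt_coordField hx i) univ_mem
      (hYe.mono fun q hq => hq i)
  rw [hc, covariantDerivative_coordField cov hx, funext hYx]
  rw [← form_coordField ε hx]
  let ℓ := (ε x).toMultilinearMap.toLinearMap (fun j => coordField x₀ j x) i
  change ℓ (∑ j, realChristoffel cov x₀ j k i x • coordField x₀ j x) = _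
  rw [map_sum, Finset.sum_eq_single i]
  · rw [map_smul, smul_eq_mul]
    congr 1
    exact congrArg (ε x) (Function.update_eq_self _ _)
  · intro j _ hji
    rw [map_smul]
    have : ℓ (coordField x₀ j x) = 0 := by
      refine (ε x).map_eq_zero_of_eq _ (i := i) (j := j) ?_ hji.symm
      rw [Function.update_self, Function.update_of_ne hji]
    rw [this, smul_zero]
  · simp

/-- Of the two Christoffel terms in `∑ⱼ ∇ⱼπ^{ij}`, the one with `Γ^i_{jl} π^{lj}` pairs a symmetric
with an antisymmetric array and vanishes. The other contains the trace of `Γ`, which is the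
logarithmic derivative of `ρ` by `fderiv_chartDensity`. -/
theorem sum_covDerivComponent {cov : AffineConnection n M} (hcov : cov.torsion = 0)
    {ε : ∀ x : M, TangentSpace (𝓡 n) x [⋀^Fin n]→L[ℝ] ℝ} (hε : IsSmoothForm ε)
    (hpar : IsParallel cov ε) {π : ∀ x : M, BivectorAt n x} (hπ : IsSmoothBivector π) {x₀ x : M}
    (hx : x ∈ (extChartAt (𝓡 n) x₀).source) (i : Fin n) :
    chartDivergence π ε x₀ i (extChartAt (𝓡 n) x₀ x) =
      (chartDensity ε x₀ (extChartAt (𝓡 n) x₀ x) : ℂ) *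
        ∑ j, covDerivComponent cov π x₀ j i j x := by
  set y := extChartAt (𝓡 n) x₀ x with hy
  have hnhds := (isOpen_chartTarget x₀).mem_nhds ((extChartAt (𝓡 n) x₀).map_source hx)
  have hd : DifferentiableAt ℝ (chartDensity ε x₀) y :=
    ((contDiffOn_chartDensity hε x₀).contDiffAt hnhds).differentiableAt (by simp)
  have hinv : (extChartAt (𝓡 n) x₀).symm y = x := (extChartAt (𝓡 n) x₀).left_inv hx
  have h1 : ∀ j, fderiv ℝ (densityComponent π ε x₀ i j) y (EuclideanSpace.single j 1) =
      (chartDensity ε x₀ y : ℂ) * fderiv ℝ (fun y => component π x₀ i j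
        ((extChartAt (𝓡 n) x₀).symm y)) y (EuclideanSpace.single j 1) +
      (chartDensity ε x₀ y : ℂ) * ((∑ l, christoffel cov x₀ l j l x) * component π x₀ i j x) := by
    intro j
    have hp : DifferentiableAt ℝ (fun y => component π x₀ i j ((extChartAt (𝓡 n) x₀).symm y)) y :=
      ((hπ x₀ i j).contDiffAt hnhds).differentiableAt (by simp)
    have hm := (Complex.ofRealCLM.hasFDerivAt.comp y hd.hasFDerivAt).mul hp.hasFDerivAt
    have hm' : HasFDerivAt (densityComponent π ε x₀ i j) _ y := hm
    rw [hm'.fderiv]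
    simp only [christoffel_eq cov hx]
    have hf := fderiv_chartDensity hε hpar hx j
    rw [← hy] at hf
    simp only [add_apply, smul_apply, smul_eq_mul, ContinuousLinearMap.comp_apply,
      Function.comp_apply, Complex.ofRealCLM_apply, hf, hinv]
    push_cast
    ring
  have h2 : ∑ j, ∑ l, christoffel cov x₀ i j l x * component π x₀ l j x = 0 := by
    have h3 : ∑ j, ∑ l, christoffel cov x₀ i j l x * component π x₀ l j x =
        - ∑ j, ∑ l, christoffel cov x₀ i j l x * component π x₀ l j x := by
      conv_lhs => rw [Finset.sum_comm]
      rw [← Finset.sum_neg_distrib]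
      refine Finset.sum_congr rfl fun a _ => ?_
      rw [← Finset.sum_neg_distrib]
      refine Finset.sum_congr rfl fun b _ => ?_
      rw [christoffel_symm hcov hx, component_swap]
      ring
    exact self_eq_neg.1 h3
  have h4 : ∑ j, ∑ l, christoffel cov x₀ j j l x * component π x₀ i l x =
      ∑ j, (∑ l, christoffel cov x₀ l j l x) * component π x₀ i j x := by
    rw [Finset.sum_comm]
    refine Finset.sum_congr rfl fun a _ => ?_
    rw [Finset.sum_mul]
    refine Finset.sum_congr rfl fun b _ => ?_
    rw [christoffel_symm hcov hx]
  rw [chartDivergence, Finset.sum_congr rfl fun j _ => h1 j]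
  simp only [covDerivComponent, Finset.sum_add_distrib, ← Finset.mul_sum]
  rw [h2, h4, ← hy]
  ring

/-- For a torsion-free connection preserving the volume form, a bivector field has zero divergence
if and only if the divergence of `ρ π` vanishes in all charts. -/
theorem isDivergenceFree_iff {cov : AffineConnection n M} (hcov : cov.torsion = 0)
    {ε : ∀ x : M, TangentSpace (𝓡 n) x [⋀^Fin n]→L[ℝ] ℝ} (hε : IsVolumeForm ε)
    (hpar : IsParallel cov ε) {π : ∀ x : M, BivectorAt n x} (hπ : IsSmoothBivector π) :
    IsDivergenceFree cov π ↔ ∀ x₀ : M, ∀ x ∈ (extChartAt (𝓡 n) x₀).source, ∀ i,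
        chartDivergence π ε x₀ i (extChartAt (𝓡 n) x₀ x) = 0 := by
  refine forall_congr' fun x₀ => forall_congr' fun x => forall_congr' fun hx =>
    forall_congr' fun i => ?_
  rw [sum_covDerivComponent hcov hε.1 hpar hπ hx]
  have := chartDensity_ne_zero hε ((extChartAt (𝓡 n) x₀).map_source hx)
  rw [mul_eq_zero, or_iff_right (Complex.ofReal_ne_zero.2 this)]

end ConnectionCoordinates

/-! ### Computing the integral in a single chart -/

section IntegralInChart

variable {n : ℕ} {M : Type*} [TopologicalSpace M] [ChartedSpace (EuclideanSpace ℝ (Fin n)) M]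

theorem transition_image_overlap (x₀ x₁ : M) :
    transition n x₀ x₁ '' overlap n x₀ x₁ = overlap n x₁ x₀ := by
  ext z
  constructor
  · rintro ⟨y, hy, rfl⟩
    have h0 : (extChartAt (𝓡 n) x₀).symm (transition n x₀ x₁ y) = (extChartAt (𝓡 n) x₁).symm y :=
      (extChartAt (𝓡 n) x₀).left_inv hy.2
    exact ⟨(extChartAt (𝓡 n) x₀).map_source hy.2, by
      rw [mem_preimage, h0]; exact (extChartAt (𝓡 n) x₁).map_target hy.1⟩
  · intro hz
    have h0 : (extChartAt (𝓡 n) x₁).symm (transition n x₁ x₀ z) = (extChartAt (𝓡 n) x₀).symm z :=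
      (extChartAt (𝓡 n) x₁).left_inv hz.2
    refine ⟨transition n x₁ x₀ z, ⟨(extChartAt (𝓡 n) x₁).map_source hz.2, ?_⟩, ?_⟩
    · rw [mem_preimage, h0]; exact (extChartAt (𝓡 n) x₀).map_target hz.1
    · rw [transition, h0]; exact (extChartAt (𝓡 n) x₀).right_inv hz.1

theorem injOn_transition (x₀ x₁ : M) : InjOn (transition n x₀ x₁) (overlap n x₀ x₁) := by
  intro y hy z hz h
  have h1 := (extChartAt (𝓡 n) x₀).injOn hy.2 hz.2 h
  exact (extChartAt (𝓡 n) x₁).symm.injOn hy.1 hz.1 h1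

variable [IsManifold (𝓡 n) ∞ M]

theorem chartDensity_transition (ε : ∀ x : M, TangentSpace (𝓡 n) x [⋀^Fin n]→L[ℝ] ℝ) {x₀ x₁ : M}
    {y : EuclideanSpace ℝ (Fin n)} (hy : y ∈ overlap n x₀ x₁) :
    chartDensity ε x₁ y = (fderiv ℝ (transition n x₀ x₁) y).det *
      chartDensity ε x₀ (transition n x₀ x₁ y) := by
  rw [chartDensity, chartForm_transition ε hy]
  exact top_form_comp (chartForm ε x₀ (transition n x₀ x₁ y)) (fderiv ℝ (transition n x₀ x₁) y)

/-- Both integrands vanish off the overlap, on one side because of `f` and on the other because of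
`χ`. The coefficient of `ε` transforms by the Jacobian determinant, and its absolute value is the
factor in the change of variables formula, so charts need not be compatibly oriented. -/
theorem integral_chart_change (ε : ∀ x : M, TangentSpace (𝓡 n) x [⋀^Fin n]→L[ℝ] ℝ) (x₀ x₁ : M)
    {χ : M → ℝ} (hχ : ∀ p ∉ (extChartAt (𝓡 n) x₁).source, χ p = 0)
    {f : M → ℂ} (hf : ∀ p ∉ (extChartAt (𝓡 n) x₀).source, f p = 0) :
    ∫ y in (extChartAt (𝓡 n) x₁).target,
      ((χ ((extChartAt (𝓡 n) x₁).symm y) * |chartDensity ε x₁ y| : ℝ) : ℂ) *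
        f ((extChartAt (𝓡 n) x₁).symm y) =
    ∫ y in (extChartAt (𝓡 n) x₀).target,
      ((χ ((extChartAt (𝓡 n) x₀).symm y) * |chartDensity ε x₀ y| : ℝ) : ℂ) *
        f ((extChartAt (𝓡 n) x₀).symm y) := by
  rw [setIntegral_eq_of_subset_of_forall_sdiff_eq_zero (s := overlap n x₀ x₁)
    (isOpen_chartTarget x₁).measurableSet inter_subset_left (fun y hy => by
      rw [hf _ fun h => hy.2 ⟨hy.1, h⟩, mul_zero]),
    setIntegral_eq_of_subset_of_forall_sdiff_eq_zero (s := overlap n x₁ x₀)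
    (isOpen_chartTarget x₀).measurableSet inter_subset_left (fun y hy => by
      rw [hχ _ fun h => hy.2 ⟨hy.1, h⟩]; simp),
    ← transition_image_overlap x₀ x₁, integral_image_eq_integral_abs_det_fderiv_smul volume
      (isOpen_overlap x₀ x₁).measurableSet (fun y hy => ((contDiffAt_transition hy).differentiableAt
        (by simp)).hasFDerivAt.hasFDerivWithinAt) (injOn_transition x₀ x₁)]
  refine setIntegral_congr_fun (isOpen_overlap x₀ x₁).measurableSet fun y hy => ?_
  have h0 : (extChartAt (𝓡 n) x₀).symm (transition n x₀ x₁ y) = (extChartAt (𝓡 n) x₁).symm y :=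
    (extChartAt (𝓡 n) x₀).left_inv hy.2
  simp only [h0, chartDensity_transition ε hy, abs_mul, Complex.real_smul]
  push_cast
  ring

variable [T2Space M] [SigmaCompactSpace M]

theorem chartPartition_eq_zero (c : M) {p : M} (hp : p ∉ (extChartAt (𝓡 n) c).source) :
    chartPartition n M c p = 0 := by
  have h := (SmoothPartitionOfUnity.exists_isSubordinate_chartAt_source (𝓡 n) M).choose_spec c
  rw [extChartAt_source] at hp
  exact image_eq_zero_of_notMem_tsupport fun hp' => hp (h hp')

/-- Each piece of the partition of unity is moved to the one chart containing `K`, where the weights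
add up to `1`. Compactness of `K` leaves finitely many nonzero pieces, so sum and integral may be
exchanged. -/
theorem integral_eq_integral_chart {ε : ∀ x : M, TangentSpace (𝓡 n) x [⋀^Fin n]→L[ℝ] ℝ}
    (hε : IsSmoothForm ε) {x₀ : M} {f : M → ℂ} (hfc : Continuous f) {K : Set M}
    (hK : IsCompact K) (hKs : K ⊆ (extChartAt (𝓡 n) x₀).source) (hfK : ∀ p ∉ K, f p = 0) :
    integral ε f = ∫ y in (extChartAt (𝓡 n) x₀).target,
      ((|chartDensity ε x₀ y| : ℝ) : ℂ) * f ((extChartAt (𝓡 n) x₀).symm y) := by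
  have hf : ∀ p ∉ (extChartAt (𝓡 n) x₀).source, f p = 0 := fun p hp => hfK p fun h => hp (hKs h)
  rw [integral]
  have h1 : ∀ c : M, _ := fun c => integral_chart_change ε x₀ c
    (fun p hp => chartPartition_eq_zero c hp) hf
  rw [finsum_congr h1]
  have hfin := (chartPartition n M).locallyFinite.finite_nonempty_inter_compact hK
  have hzero : ∀ c ∉ hfin.toFinset, ∀ p, chartPartition n M c p ≠ 0 → f p = 0 := by
    intro c hc p hp
    by_contra hfp
    refine hc (hfin.mem_toFinset.2 ⟨p, hp, ?_⟩)
    by_contra hpK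
    exact hfp (hfK p hpK)
  rw [finsum_eq_sum_of_support_subset (s := hfin.toFinset) _ (fun c hc => by
    by_contra hcS
    refine hc (integral_eq_zero_of_ae (Eventually.of_forall fun y => ?_))
    change ((_ * _ : ℝ) : ℂ) * f _ = 0
    by_cases h : chartPartition n M c ((extChartAt (𝓡 n) x₀).symm y) = 0
    · rw [h, zero_mul, Complex.ofReal_zero, zero_mul]
    · rw [hzero c hcS _ h, mul_zero])]
  rw [← integral_finsetSum]
  · refine setIntegral_congr_fun (isOpen_chartTarget x₀).measurableSet fun y _ => ?_
    set p := (extChartAt (𝓡 n) x₀).symm y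
    by_cases hp : f p = 0
    · simp [hp]
    have hsum : ∑ c ∈ hfin.toFinset, chartPartition n M c p = 1 := by
      rw [← (chartPartition n M).sum_eq_one (mem_univ p)]
      refine (finsum_eq_sum_of_support_subset _ fun c hc => ?_).symm
      by_contra hcS
      exact hp (hzero c hcS p hc)
    rw [← Finset.sum_mul, ← Complex.ofReal_sum, ← Finset.sum_mul, hsum, one_mul]
  · intro c _
    have hK' : IsCompact (extChartAt (𝓡 n) x₀ '' K) :=
      hK.image_of_continuousOn ((continuousOn_extChartAt x₀).mono hKs)
    have hK't : extChartAt (𝓡 n) x₀ '' K ⊆ (extChartAt (𝓡 n) x₀).target := by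
      rintro _ ⟨p, hp, rfl⟩
      exact (extChartAt (𝓡 n) x₀).map_source (hKs hp)
    refine IntegrableOn.of_forall_sdiff_eq_zero (s := extChartAt (𝓡 n) x₀ '' K) ?_
      (isOpen_chartTarget x₀).measurableSet fun y hy => ?_
    · refine ContinuousOn.integrableOn_compact hK' (ContinuousOn.mono ?_ hK't)
      have hs := continuousOn_extChartAt_symm (I := 𝓡 n) x₀
      refine ContinuousOn.mul
        (Complex.continuous_ofReal.comp_continuousOn (ContinuousOn.mul ?_ ?_)) ?_
      · exact (chartPartition n M c).contMDiff.continuous.comp_continuousOn hs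
      · exact (contDiffOn_chartDensity hε x₀).continuousOn.abs
      · exact hfc.comp_continuousOn hs
    · rw [hfK _ fun h => hy.2 ⟨_, h, (extChartAt (𝓡 n) x₀).right_inv hy.1⟩, mul_zero]

end IntegralInChart

/-! ### From vanishing integrals to vanishing divergence -/

section DivergenceOfPoisson

theorem integrable_mul_of_tsupport_subset {n : ℕ} {T : Set (EuclideanSpace ℝ (Fin n))}
    {F h : EuclideanSpace ℝ (Fin n) → ℂ} (hF : ContinuousOn F T) (hh : Continuous h)
    (hc : HasCompactSupport h) (ht : tsupport h ⊆ T) : Integrable (fun y => F y * h y) := by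
  rw [← integrableOn_univ]
  refine IntegrableOn.of_forall_sdiff_eq_zero (s := tsupport h) ?_ MeasurableSet.univ fun y hy => ?_
  · exact ContinuousOn.integrableOn_compact hc.isCompact ((hF.mono ht).mul hh.continuousOn)
  · rw [image_eq_zero_of_notMem_tsupport hy.2, mul_zero]

theorem sum_smul_comp {n : ℕ} {V : Type*} [AddCommGroup V] [Module ℝ V] [TopologicalSpace V]
    (c : Fin n → ℂ) (L : Fin n → EuclideanSpace ℝ (Fin n) →L[ℝ] ℂ)
    (m : V →L[ℝ] EuclideanSpace ℝ (Fin n)) :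
    (∑ j, c j • L j) ∘L m = ∑ j, c j • (L j ∘L m) := by
  ext v
  simp

/-- The fundamental lemma of the calculus of variations, for divergences. -/
theorem divergence_eq_zero_of_integral {n : ℕ} {U : Set (EuclideanSpace ℝ (Fin n))} (hU : IsOpen U)
    {u : Fin n → EuclideanSpace ℝ (Fin n) → ℂ} (hu : ∀ j, ContDiffOn ℝ ∞ (u j) U)
    (h : ∀ g : EuclideanSpace ℝ (Fin n) → ℝ, ContDiff ℝ ∞ g → HasCompactSupport g →
      tsupport g ⊆ U → ∫ y, ∑ j, u j y *
        fderiv ℝ (fun y => (g y : ℂ)) y (EuclideanSpace.single j 1) = 0)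
    {y₀ : EuclideanSpace ℝ (Fin n)} (hy₀ : y₀ ∈ U) :
    ∑ j, fderiv ℝ (u j) y₀ (EuclideanSpace.single j 1) = 0 := by
  let W : EuclideanSpace ℝ (Fin n) → ℂ :=
    fun y => ∑ j, fderiv ℝ (u j) y (EuclideanSpace.single j 1)
  have hduc : ∀ j, ContinuousOn (fun y => fderiv ℝ (u j) y (EuclideanSpace.single j 1)) U :=
    fun j => ((hu j).continuousOn_fderiv_of_isOpen hU (by simp)).clm_apply continuousOn_const
  have hW : ContinuousOn W U := continuousOn_finsetSum _ fun j _ => hduc j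
  have hae : ∀ᵐ y, y ∈ U → W y = 0 := by
    refine hU.ae_eq_zero_of_integral_contDiff_smul_eq_zero
      (hW.locallyIntegrableOn hU.measurableSet) fun g hg hgc hgt => ?_
    let G : EuclideanSpace ℝ (Fin n) → ℂ := fun y => (g y : ℂ)
    have hGs : Function.support G = Function.support g := by ext y; simp [G]
    have hGt : tsupport G = tsupport g := by rw [tsupport, hGs, tsupport]
    have hG : ContDiff ℝ ∞ G := Complex.ofRealCLM.contDiff.comp hg
    have hGc : HasCompactSupport G := by rw [HasCompactSupport, hGt]; exact hgc
    have hGU : tsupport G ⊆ U := by rwa [hGt]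
    let dG : Fin n → EuclideanSpace ℝ (Fin n) → ℂ :=
      fun j y => fderiv ℝ G y (EuclideanSpace.single j 1)
    have hdGc : ∀ j, Continuous (dG j) := fun j =>
      (hG.continuous_fderiv (by simp)).clm_apply continuous_const
    have hdGsub : ∀ j, tsupport (dG j) ⊆ tsupport G := fun j =>
      closure_minimal (fun y hy => by
        refine support_fderiv_subset ℝ (f := G) fun h0 => hy ?_
        simp only [dG, h0]; rfl) (isClosed_tsupport G)
    have hdGcs : ∀ j, HasCompactSupport (dG j) := fun j =>
      hGc.isCompact.of_isClosed_subset (isClosed_tsupport _) (hdGsub j)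
    have i1 : ∀ j, Integrable (fun y => u j y * dG j y) := fun j =>
      integrable_mul_of_tsupport_subset (hu j).continuousOn (hdGc j) (hdGcs j)
        ((hdGsub j).trans hGU)
    have i2 : ∀ j, Integrable (fun y =>
        fderiv ℝ (u j) y (EuclideanSpace.single j 1) * G y) := fun j =>
      integrable_mul_of_tsupport_subset (hduc j) hG.continuous hGc hGU
    have i3 : ∀ j, Integrable (fun y => u j y * G y) := fun j =>
      integrable_mul_of_tsupport_subset (hu j).continuousOn hG.continuous hGc hGU
    -- There is no boundary term because `G` has compact support in `U`. The field `u` is smooth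
    -- only on `U`, which suffices for the same reason.
    have hparts : ∀ j, ∫ y, u j y * dG j y =
        -∫ y, fderiv ℝ (u j) y (EuclideanSpace.single j 1) * G y := fun j =>
      integral_mul_fderiv_eq_neg_fderiv_mul_of_integrable (i2 j) (i1 j) (i3 j)
        (fun y hy => ((hu j).contDiffAt (hU.mem_nhds (hGU hy))).differentiableAt (by simp))
        (fun y _ => hG.differentiable (by simp) y)
    have h1 := h g hg hgc hgt
    change ∫ y, ∑ j, u j y * dG j y = 0 at h1
    rw [integral_finsetSum _ fun j _ => i1 j, Finset.sum_congr rfl fun j _ => hparts j,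
      Finset.sum_neg_distrib, neg_eq_zero, ← integral_finsetSum _ fun j _ => i2 j] at h1
    rw [← h1]
    refine integral_congr_ae (Eventually.of_forall fun y => ?_)
    simp only [W, G, Complex.real_smul, Finset.mul_sum]
    exact Finset.sum_congr rfl fun j _ => mul_comm _ _
  -- Continuity of `W` on the open set `U` upgrades vanishing almost everywhere to vanishing at
  -- `y₀`.
  exact Measure.eqOn_open_of_ae_eq (μ := volume) (g := fun _ => (0 : ℂ))
    ((ae_restrict_iff' hU.measurableSet).2 hae) hU hW continuousOn_const hy₀

variable {n : ℕ} {M : Type*} [TopologicalSpace M] [ChartedSpace (EuclideanSpace ℝ (Fin n)) M]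
  [IsManifold (𝓡 n) ∞ M] [T2Space M] [SigmaCompactSpace M]

/-- If all integrals of `π(df, dg)` vanish, then `ρ π` has zero divergence in charts. -/
theorem chartDivergence_eq_zero_of_integral
    {ε : ∀ x : M, TangentSpace (𝓡 n) x [⋀^Fin n]→L[ℝ] ℝ} (hε : IsVolumeForm ε)
    {π : ∀ x : M, BivectorAt n x} (hπ : IsSmoothBivector π)
    {B : SmoothCompact n M → SmoothCompact n M → SmoothCompact n M}
    (hB : ∀ (f g : SmoothCompact n M) (x : M), (B f g : M → ℂ) x =
      π x ![differential (f : M → ℂ) x, differential (g : M → ℂ) x])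
    (hint : ∀ f g, integral ε (B f g : M → ℂ) = 0) (x₀ : M) {y₀ : EuclideanSpace ℝ (Fin n)}
    (hy₀ : y₀ ∈ (extChartAt (𝓡 n) x₀).target) (i : Fin n) :
    chartDivergence π ε x₀ i y₀ = 0 := by
  set T := (extChartAt (𝓡 n) x₀).target with hT
  have hTo : IsOpen T := isOpen_chartTarget x₀
  obtain ⟨ψ, hψ, -, hψ1⟩ := exists_isChartTest x₀ hy₀ univ_mem
  let L : Fin n → (EuclideanSpace ℝ (Fin n) →L[ℝ] ℂ) :=
    fun i => Complex.ofRealCLM ∘L EuclideanSpace.proj i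
  have hρ := contDiffOn_chartDensity hε.1 x₀
  have hsign : ∀ᶠ y in 𝓝 y₀, 0 < chartDensity ε x₀ y * chartDensity ε x₀ y₀ :=
    Tendsto.eventually_const_lt (mul_self_pos.2 (chartDensity_ne_zero hε hy₀))
      ((hρ.continuousOn.continuousAt (hTo.mem_nhds hy₀)).mul_const _)
  -- The integral involves `|ρ|` and the divergence involves `ρ`. On `U` the sign of `ρ` is constant
  -- and `ψ` is locally `1`, so for test functions supported in `U` they differ by a constant sign
  -- and `ψ xⁱ` acts as `xⁱ`.
  obtain ⟨U, hUsub, hUo, hyU⟩ := eventually_nhds_iff.1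
    ((hTo.eventually_mem hy₀).and (hψ1.eventually_nhds.and hsign))
  refine divergence_eq_zero_of_integral hUo (u := densityComponent π ε x₀ i)
    (fun j => (contDiffOn_densityComponent hε.1 hπ x₀ i j).mono fun y hy => (hUsub y hy).1)
    (fun g hg hgc hgt => ?_) hyU
  let G : EuclideanSpace ℝ (Fin n) → ℂ := fun y => (g y : ℂ)
  have hGs : Function.support G = Function.support g := by ext y; simp [G]
  have hGt : tsupport G = tsupport g := by rw [tsupport, hGs, tsupport]
  have hG : IsChartTest x₀ G :=
    ⟨Complex.ofRealCLM.contDiff.comp hg, by rw [HasCompactSupport, hGt]; exact hgc, by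
      rw [hGt]; exact fun y hy => (hUsub y (hgt hy)).1⟩
  -- The bracket of the cut-off coordinate `ψ xⁱ` with the test function: on `U` it equals `∑ⱼ
  -- π^{ij} ∂ⱼG`, and it vanishes wherever `dG` does.
  set b := B (chartLift (hψ.mul_left (L i).contDiff)) (chartLift hG) with hb
  have hdG : ∀ y, fderiv ℝ G y = ∑ j, fderiv ℝ G y (EuclideanSpace.single j 1) • L j :=
    fun y => covector_eq_sum _
  have hbU : ∀ y ∈ U, (b : M → ℂ) ((extChartAt (𝓡 n) x₀).symm y) =
      ∑ j, component π x₀ i j ((extChartAt (𝓡 n) x₀).symm y) *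
        fderiv ℝ G y (EuclideanSpace.single j 1) := by
    intro y hy
    have hyT := (hUsub y hy).1
    have hs := (extChartAt (𝓡 n) x₀).map_target hyT
    have hr := (extChartAt (𝓡 n) x₀).right_inv hyT
    have h1 : differential (n := n) (chartLift hG : M → ℂ) ((extChartAt (𝓡 n) x₀).symm y) =
        ∑ j, fderiv ℝ G y (EuclideanSpace.single j 1) •
          coordCovector x₀ j ((extChartAt (𝓡 n) x₀).symm y) := by
      simp_rw [differential_chartLift hG hs, hr, coordCovector_eq hs]
      conv_lhs => rw [hdG y]
      exact sum_smul_comp _ _ _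
    rw [hb, hB, differential_chartLift_mul hψ _ hs (by rw [hr]; exact (hUsub y hy).2.1), h1,
      ← coordCovector_eq hs, ← bivectorBilin_apply, map_sum]
    refine Finset.sum_congr rfl fun j _ => ?_
    rw [map_smul, smul_eq_mul, mul_comm]
    rfl
  have hb0 : ∀ y ∈ T, y ∉ tsupport G → (b : M → ℂ) ((extChartAt (𝓡 n) x₀).symm y) = 0 := by
    intro y hy hyG
    have hs := (extChartAt (𝓡 n) x₀).map_target hy
    have hr := (extChartAt (𝓡 n) x₀).right_inv hy
    have hd0 : fderiv ℝ G y = 0 := by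
      by_contra h0
      exact hyG (support_fderiv_subset ℝ h0)
    have h1 : differential (n := n) (chartLift hG : M → ℂ) ((extChartAt (𝓡 n) x₀).symm y) = 0 := by
      rw [differential_chartLift hG hs, hr, hd0]; rfl
    rw [hb, hB, h1, ← bivectorBilin_apply, map_zero]
  set K := (extChartAt (𝓡 n) x₀).symm '' tsupport G with hK
  have hKc : IsCompact K := hG.hasCompactSupport.isCompact.image_of_continuousOn
    ((continuousOn_extChartAt_symm x₀).mono hG.tsupport_subset)
  have hKs : K ⊆ (extChartAt (𝓡 n) x₀).source := by
    rintro _ ⟨y, hy, rfl⟩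
    exact (extChartAt (𝓡 n) x₀).map_target (hG.tsupport_subset hy)
  have hbK : ∀ p ∉ K, (b : M → ℂ) p = 0 := by
    intro p hp
    have h1 : differential (n := n) (chartLift hG : M → ℂ) p = 0 := by
      have he : (chartLift hG : M → ℂ) =ᶠ[𝓝 p] fun _ => 0 := by
        filter_upwards [hKc.isClosed.isOpen_compl.mem_nhds hp] with q hq
        by_cases hqs : q ∈ (extChartAt (𝓡 n) x₀).source
        · rw [chartLift_of_mem hG hqs]
          by_contra hne
          exact hq ⟨_, subset_tsupport G hne, (extChartAt (𝓡 n) x₀).left_inv hqs⟩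
        · exact chartLift_of_notMem hG hqs
      rw [differential, he.mfderiv_eq, mfderiv_const]
      rfl
    rw [hb, hB, h1, ← bivectorBilin_apply, map_zero]
  have hI := hint (chartLift (hψ.mul_left (L i).contDiff)) (chartLift hG)
  rw [← hb, integral_eq_integral_chart hε.1 (ContMDiff.continuous b.2.1) hKc hKs hbK] at hI
  set s : ℝ := ((SignType.sign (chartDensity ε x₀ y₀) : SignType) : ℝ) with hs
  have habs : ∀ y ∈ U, |chartDensity ε x₀ y| = s * chartDensity ε x₀ y := by
    intro y hy
    have h := (hUsub y hy).2.2
    rcases lt_or_gt_of_ne (chartDensity_ne_zero hε hy₀) with h0 | h0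
    · rw [abs_of_neg (by nlinarith), hs, sign_neg h0]; simp
    · rw [abs_of_pos (by nlinarith), hs, sign_pos h0]; simp
  -- Since `s² = 1`, multiplying by `s` replaces `|ρ|` by `ρ`. Off the support of `G` both sides are
  -- zero, so the integral over `ℝⁿ` is `s` times the vanishing integral of the bracket.
  have hfun : (fun y => ∑ j, densityComponent π ε x₀ i j y *
      fderiv ℝ G y (EuclideanSpace.single j 1)) = T.indicator fun y => (s : ℂ) *
        (((|chartDensity ε x₀ y| : ℝ) : ℂ) * (b : M → ℂ) ((extChartAt (𝓡 n) x₀).symm y)) := by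
    funext y
    by_cases hyG : y ∈ tsupport G
    · have hyU' : y ∈ U := hgt (hGt ▸ hyG)
      rw [indicator_of_mem (hUsub y hyU').1, hbU y hyU', habs y hyU', Finset.mul_sum,
        Finset.mul_sum]
      refine Finset.sum_congr rfl fun j _ => ?_
      have hss : (s : ℂ) * s = 1 := by
        rw [← Complex.ofReal_mul, hs]
        rcases lt_or_gt_of_ne (chartDensity_ne_zero hε hy₀) with h | h <;> simp [h]
      rw [densityComponent]
      push_cast
      linear_combination (-(chartDensity ε x₀ y : ℂ) *
        component π x₀ i j ((extChartAt (𝓡 n) x₀).symm y) *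
        fderiv ℝ G y (EuclideanSpace.single j 1)) * hss
    · have hd0 : fderiv ℝ G y = 0 := by
        by_contra h0
        exact hyG (support_fderiv_subset ℝ h0)
      rw [hd0]
      by_cases hyT : y ∈ T
      · rw [indicator_of_mem hyT, hb0 y hyT hyG]; simp
      · rw [indicator_of_notMem hyT]; simp
  change ∫ y, ∑ j, densityComponent π ε x₀ i j y *
      fderiv ℝ G y (EuclideanSpace.single j 1) = 0
  rw [hfun, integral_indicator hTo.measurableSet, integral_const_mul, hI, mul_zero]

end DivergenceOfPoisson

end NCDeformation

end

/-! ### The main theorem -/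

theorem mainTheorem3 {n : ℕ} {M : Type*} [TopologicalSpace M]
    [ChartedSpace (EuclideanSpace ℝ (Fin n)) M] [IsManifold (𝓡 n) ∞ M]
    [T2Space M] [SigmaCompactSpace M]
    {𝕜 A : Type*} [CommRing 𝕜] [Algebra ℂ 𝕜] [NonUnitalRing A] [Module 𝕜 A]
    [IsScalarTower 𝕜 A A] [SMulCommClass 𝕜 A A] [Module ℂ A] [IsScalarTower ℂ 𝕜 A]
    (D : NCDeformation.SmoothDeformation n M 𝕜 A)
    (ε : ∀ x : M, TangentSpace (𝓡 n) x [⋀^Fin n]→L[ℝ] ℝ)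
    (hε : NCDeformation.IsVolumeForm ε)
    (τ : A →ₗ[𝕜] 𝕜) (hτ : ∀ a b : A, τ (a * b) = τ (b * a))
    (hτε : ∀ a : A, algebraMap ℂ (𝕜 ⧸ Ideal.span {D.κ})
        (NCDeformation.integral ε (D.reduce a : M → ℂ)) =
      Ideal.Quotient.mk (Ideal.span {D.κ}) (τ a)) :
    (∃! π : ∀ x : M, NCDeformation.BivectorAt n x, NCDeformation.IsPoissonField D π) ∧
    (∀ π : ∀ x : M, NCDeformation.BivectorAt n x, NCDeformation.IsPoissonField D π →
      (∀ x, NCDeformation.exteriorDerivative (NCDeformation.contract π ε) x = 0) ∧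
      ∀ cov : NCDeformation.AffineConnection n M, cov.torsion = 0 →
        NCDeformation.IsParallel cov ε → NCDeformation.IsDivergenceFree cov π) ∧
    (∀ π : ∀ x : M, NCDeformation.BivectorAt n x, NCDeformation.IsSmoothBivector π →
      ∀ cov : NCDeformation.AffineConnection n M, cov.torsion = 0 →
        NCDeformation.IsParallel cov ε →
        ((∀ x, NCDeformation.exteriorDerivative (NCDeformation.contract π ε) x = 0) ↔
          NCDeformation.IsDivergenceFree cov π)) := by
  have hint := D.integral_bracket ε τ hτ hτε
  have hdiv : ∀ π : ∀ x : M, NCDeformation.BivectorAt n x, NCDeformation.IsPoissonField D π →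
      ∀ x₀ : M, ∀ x ∈ (extChartAt (𝓡 n) x₀).source, ∀ i,
        NCDeformation.chartDivergence π ε x₀ i (extChartAt (𝓡 n) x₀ x) = 0 :=
    fun π hπ x₀ x hx i => NCDeformation.chartDivergence_eq_zero_of_integral hε hπ.1 hπ.2 hint x₀
      ((extChartAt (𝓡 n) x₀).map_source hx) i
  refine ⟨NCDeformation.existsUnique_isPoissonField D, fun π hπ => ⟨?_, fun cov hcov hpar => ?_⟩,
    fun π hπ cov hcov hpar => ?_⟩
  · exact (NCDeformation.closed_contract_iff hε.1 hπ.1).2 (hdiv π hπ)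
  · exact (NCDeformation.isDivergenceFree_iff hcov hε hpar hπ.1).2 (hdiv π hπ)
  · rw [NCDeformation.closed_contract_iff hε.1 hπ,
      NCDeformation.isDivergenceFree_iff hcov hε hpar hπ]
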